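/- Let $[X:Y:Z]$ be homogeneous coordinates on $\mathbb{P}^2(\mathbb{C})$ and $L_\infty=\{Z=0\}$. A plane curve germ is of type $a_k$ (resp. $e_6$) if it is analytically equivalent to $x^2+y^{k+1}=0$ (resp. $x^3+y^4=0$) at the origin; the superscript $\infty$ marks a singular point on $L_\infty$, and singular points without it lie off $L_\infty$. For a quartic $Q$ consider the positions (i) $Q\cap L_\infty$ is two distinct smooth points of $Q$, and $L_\infty$ is tangent to $Q$ at both; (ii) $Q\cap L_\infty$ is two points, one a smooth point of $Q$ at which $L_\infty$ is tangent to $Q$, the other a singular point of $Q$; (iv) $Q\cap L_\infty$ is one smooth point of $Q$, with intersection multiplicity $4$; (v) $Q\cap L_\infty$ is one singular point of $Q$, with intersection multiplicity $4$. Let $\mathcal{QL}(n)$ be the set of quartics $Q$ whose set of singular points and whose position are exactly: $\mathcal{QL}(1)$: $2a_2$, (i); $\mathcal{QL}(2)$: $2a_2$, (iv); $\mathcal{QL}(3)$: $2a_2+a_1$, (i); $\mathcal{QL}(4)$: $2a_2+a_1$, (iv); $\mathcal{QL}(5)$: $3a_2$, (i); $\mathcal{QL}(6)$: $a_2+a_3^\infty$,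 (ii); $\mathcal{QL}(7)$: $a_5$, (i); $\mathcal{QL}(8)$: $a_5$, (iv); $\mathcal{QL}(9)$: $a_6^\infty$, (ii); $\mathcal{QL}(10)$: $a_4^\infty+a_2$, (v); $\mathcal{QL}(11)$: $e_6$, (i); $\mathcal{QL}(12)$: $e_6$, (iv). An analytic family of quartics is given by non-zero quartic forms whose coefficients are analytic in the parameters. Write $\mathcal{QL}(n)\to\mathcal{QL}(m)$ if there are an open neighbourhood $U$ of $0$ in $\mathbb{C}$ and an analytic family $Q(s)$, $s\in U$, of quartics with $Q(s)\in\mathcal{QL}(n)$ for $s\in U\setminus\{0\}$ and $Q(0)\in\mathcal{QL}(m)$. **Proposition.** One has $\mathcal{QL}(n)\to\mathcal{QL}(m)$ for all arrows of the diagram, that is, for $$1\to2,\ 1\to3,\ 1\to6,\ 1\to7,\ 2\to4,\ 2\to8,\ 2\to10,\ 3\to4,\ 3\to5,\ 6\to9,\ 7\to8,\ 7\to11,\ 8\to12,\ 11\to12.$$ Moreover there exist the following multi-parameter degenerations, each consisting of an analytic family of quartics over all of $\mathbb{C}^3$ or $\mathbb{C}^2$ and a polynomial $H$ in the parameters; a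 parameter point is called admissible if $H\ne0$ there. (1) A family $Q_{s,t,u}$ such that, for admissible parameters, $Q_{s,t,u}\in\mathcal{QL}(1)$ if $stu\neq0$, $Q_{0,t,u}\in\mathcal{QL}(7)$ if $tu\ne0$, and $Q_{s,0,u}\in\mathcal{QL}(2)$ if $su\neq0$; moreover all points $(0,t,0)$ and $(0,0,u)$ (including the origin) are admissible, $Q_{0,t,0}\in\mathcal{QL}(11)$ for all $t\neq0$, $Q_{0,0,u}\in\mathcal{QL}(8)$ for all $u\ne0$, and $Q_{0,0,0}\in\mathcal{QL}(12)$. (2) A family $Q_{s,t,u}$ such that, for admissible parameters, $Q_{s,t,u}\in\mathcal{QL}(1)$ if $stu\neq0$, $Q_{0,t,u}\in\mathcal{QL}(3)$ if $tu\ne0$, and $Q_{s,0,u}\in\mathcal{QL}(2)$ if $su\neq0$; moreover all points $(0,t,0)$ with $t\ne0$ and $(0,0,u)$ with $u\neq0$ are admissible, $Q_{0,t,0}\in\mathcal{QL}(5)$ for all $t\neq0$, and $Q_{0,0,u}\in\mathcal{QL}(4)$ for all $u\neq0$. (3) A family $Q_{s,t}$ such that, for admissible parameters, $Q_{s,t}\in\mathcal{QL}(1)$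 if $st\neq0$ and $Q_{0,t}\in\mathcal{QL}(6)$ if $t\neq0$; moreover the origin is admissible and $Q_{0,0}\in\mathcal{QL}(9)$. (4) A family $Q_{s,t}$ such that, for admissible parameters, $Q_{s,t}\in\mathcal{QL}(1)$ if $st\neq0$ and $Q_{0,t}\in\mathcal{QL}(2)$ if $t\neq0$; moreover the origin is admissible and $Q_{0,0}\in\mathcal{QL}(10)$. (In particular, in (1), (3) and (4) every parameter point in some neighbourhood of the origin is admissible.) -/

import Mathlib

namespace QLConf

/-- The complex projective plane, with homogeneous coordinates `[X : Y : Z]` numbered `0, 1, 2`. -/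
abbrev P2 : Type := Projectivization ℂ (Fin 3 → ℂ)

/-- The fixed line at infinity `Z = 0`. -/
def lineAtInfinity : Set P2 := {P | P.rep 2 = 0}

/-- The plane curve `F = 0` of a homogeneous polynomial `F`. -/
def curve (F : MvPolynomial (Fin 3) ℂ) : Set P2 :=
  {P | MvPolynomial.eval P.rep F = 0}

/-- The set of singular points of the curve `F = 0`. -/
def singularLocus (F : MvPolynomial (Fin 3) ℂ) : Set P2 :=
  {P | P ∈ curve F ∧ ∀ i, MvPolynomial.eval P.rep (MvPolynomial.pderiv i F) = 0}

/-- The singularity types that occur: `a n : x ^ 2 + y ^ (n + 1) = 0` and `e6 : x ^ 3 + y ^ 4 = 0`. -/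
inductive SingularityType
  | a (n : ℕ)
  | e6

/-- The normal form of a singularity type. -/
def SingularityType.normalForm : SingularityType → ℂ × ℂ → ℂ
  | .a n => fun p => p.1 ^ 2 + p.2 ^ (n + 1)
  | .e6 => fun p => p.1 ^ 3 + p.2 ^ 4

/-- The germ of the curve `F = 0` at `P` is, in suitable local analytic coordinates `(x, y)` of the
projective plane centred at `P`, the germ of the normal form of `τ` at the origin.

The coordinates are given by a lift `Φ` to homogeneous coordinates of the inverse of a chart:
`Φ 0` represents `P`, and `(x, y) ↦ [Φ (x, y)]` is a local biholomorphism at the origin exactly when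
`Φ 0`, `∂Φ/∂x (0)`, `∂Φ/∂y (0)` are linearly independent. Since `F` is homogeneous, `F ∘ Φ` is then
a local equation of the curve in these coordinates, which has to agree with the normal form up to
an invertible analytic factor `h`. -/
def HasSingularityAt (F : MvPolynomial (Fin 3) ℂ) (P : P2) (τ : SingularityType) : Prop :=
  ∃ (Φ : ℂ × ℂ → Fin 3 → ℂ) (h : ℂ × ℂ → ℂ),
    AnalyticAt ℂ Φ 0 ∧ AnalyticAt ℂ h 0 ∧ h 0 ≠ 0 ∧
    Φ 0 ∈ P.submodule ∧
    LinearIndependent ℂ ![Φ 0, fderiv ℂ Φ 0 (1, 0), fderiv ℂ Φ 0 (0, 1)] ∧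
    ∀ᶠ p in nhds (0 : ℂ × ℂ), MvPolynomial.eval (Φ p) F = h p * τ.normalForm p

/-- Where a singular point lies relative to the line at infinity. -/
inductive Place
  | affine
  | infinity

/-- Being at the given place. -/
def Place.Contains : Place → P2 → Prop
  | .affine, P => P ∉ lineAtInfinity
  | .infinity, P => P ∈ lineAtInfinity

/-- The singular points of `F = 0` are exactly those of the list `σ`: one point for each entry,
of the given type and at the given place, and no other. -/
def HasSingularities (F : MvPolynomial (Fin 3) ℂ) (σ : List (SingularityType × Place)) : Prop :=
  ∃ P : Fin σ.length → P2, Function.Injective P ∧ Set.range P = singularLocus F ∧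
    ∀ i, HasSingularityAt F (P i) (σ.get i).1 ∧ (σ.get i).2.Contains (P i)

/-- For a point `P` on the line at infinity: the intersection multiplicity at `P` of the curve
`F = 0` with the line at infinity is `k`, that is, `k` is the order of vanishing at `0` of the
restriction of `F` to the line, in a parametrisation `[P + x V]` of the line near `P`. -/
def MeetsInfinityWithMult (F : MvPolynomial (Fin 3) ℂ) (P : P2) (k : ℕ) : Prop :=
  ∀ V : Fin 3 → ℂ, V 2 = 0 → LinearIndependent ℂ ![P.rep, V] →
    Polynomial.rootMultiplicity 0
      (MvPolynomial.aeval
        (fun i => Polynomial.C (P.rep i) + Polynomial.C (V i) * Polynomial.X) F) = k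

/-- The relative positions of a quartic and the line at infinity that occur for irreducible
quartics:
`i`: the line is tangent to the quartic at two distinct smooth points;
`ii`: the line is tangent to the quartic at a smooth point and passes through a singular point;
`iv`: the line meets the quartic at a single smooth point, with multiplicity 4;
`v`: the line meets the quartic at a single singular point, with multiplicity 4. -/
inductive Position
  | i
  | ii
  | iv
  | v

/-- The quartic `F = 0` is in the given position relative to the line at infinity. -/
def Position.Holds : Position → MvPolynomial (Fin 3) ℂ → Prop
  | .i, F => ∃ R₁ R₂ : P2, R₁ ≠ R₂ ∧ curve F ∩ lineAtInfinity = {R₁, R₂} ∧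
      R₁ ∉ singularLocus F ∧ MeetsInfinityWithMult F R₁ 2 ∧
      R₂ ∉ singularLocus F ∧ MeetsInfinityWithMult F R₂ 2
  | .ii, F => ∃ R₁ R₂ : P2, R₁ ≠ R₂ ∧ curve F ∩ lineAtInfinity = {R₁, R₂} ∧
      R₁ ∉ singularLocus F ∧ MeetsInfinityWithMult F R₁ 2 ∧
      R₂ ∈ singularLocus F
  | .iv, F => ∃ R : P2, curve F ∩ lineAtInfinity = {R} ∧
      R ∉ singularLocus F ∧ MeetsInfinityWithMult F R 4
  | .v, F => ∃ R : P2, curve F ∩ lineAtInfinity = {R} ∧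
      R ∈ singularLocus F ∧ MeetsInfinityWithMult F R 4

/-- The (homogeneous equations of) quartics with singularities `σ` and in position `π` relative to
the line at infinity. -/
def configuration (σ : List (SingularityType × Place)) (π : Position) :
    Set (MvPolynomial (Fin 3) ℂ) :=
  {F | F.IsHomogeneous 4 ∧ HasSingularities F σ ∧ π.Holds F}

open SingularityType Place in
/-- The classes `QL(n)`, `n = 1, …, 12`. (Quartics in these configurations are automatically
reduced and irreducible.) -/
def QL : ℕ → Set (MvPolynomial (Fin 3) ℂ)
  | 1 => configuration [(a 2, affine), (a 2, affine)] .i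
  | 2 => configuration [(a 2, affine), (a 2, affine)] .iv
  | 3 => configuration [(a 2, affine), (a 2, affine), (a 1, affine)] .i
  | 4 => configuration [(a 2, affine), (a 2, affine), (a 1, affine)] .iv
  | 5 => configuration [(a 2, affine), (a 2, affine), (a 2, affine)] .i
  | 6 => configuration [(a 2, affine), (a 3, infinity)] .ii
  | 7 => configuration [(a 5, affine)] .i
  | 8 => configuration [(a 5, affine)] .iv
  | 9 => configuration [(a 6, infinity)] .ii
  | 10 => configuration [(a 4, infinity), (a 2, affine)] .v
  | 11 => configuration [(e6, affine)] .i
  | 12 => configuration [(e6, affine)] .iv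
  | _ => ∅

/-- An analytic family of quartics over the parameter set `U`: every member is given by a non-zero
quartic form, and the coefficients are analytic in the parameter. -/
def IsAnalyticFamily {E : Type} [NormedAddCommGroup E] [NormedSpace ℂ E] (U : Set E)
    (F : E → MvPolynomial (Fin 3) ℂ) : Prop :=
  (∀ p ∈ U, (F p).IsHomogeneous 4 ∧ F p ≠ 0) ∧
    ∀ m : Fin 3 →₀ ℕ, AnalyticOnNhd ℂ (fun p => (F p).coeff m) U

/-- The relation `QL(n) → QL(m)`: there is an analytic family of quartics over an open neighbourhood
`U` of the origin of `ℂ` whose members with parameter `s ≠ 0` lie in `QL(n)` and whose member with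
`s = 0` lies in `QL(m)`. -/
def DegeneratesTo (n m : ℕ) : Prop :=
  ∃ (U : Set ℂ) (F : ℂ → MvPolynomial (Fin 3) ℂ),
    IsOpen U ∧ 0 ∈ U ∧ IsAnalyticFamily U F ∧
    (∀ s ∈ U, s ≠ 0 → F s ∈ QL n) ∧ F 0 ∈ QL m

end QLConf

namespace QLConf

open Filter Topology

/-! Every member of the families used to realise the twelve classes has the form `q² + c² X³ Z` with
`q` a conic and `c ≠ 0`. On `Z = 0` this restricts to `q²`, so the position relative to the line at
infinity is that of two, one double, or special points of `q = 0` on `Z = 0`. Singularities on the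
conic are equally visible: where `q = 0` crosses `X = 0` transversally off `Z = 0`, the functions
`q` and `x` are coordinates and `q² + c² x³` is a cusp; smooth tangency to `X = 0` gives `a₅`; a
pair of lines meeting on `X = 0`, or the double line `y² = 0`, gives `e₆`. When `q = 0` passes
through `[0 : 1 : 0]`, the singular point there is `a₃`, `a₆` or `a₄`, according to whether the
conic is transversal to both lines, tangent to `X = 0`, or tangent to `Z = 0`. Thus the
degenerations are motions of a conic relative to two fixed lines.

What remains is to control singular points off the conic. There `q² = -c² x³` is parametrised by `x
= -τ²`, `q = c τ³`, and the gradient conditions leave an overdetermined system for `τ`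
(`affinePoint_mem_singularLocus`). Eliminating `τ` contributes the main factor of the polynomial `H`
of each family. Parameters enter the conics with suitable powers, so that `H` is nonzero at the
required special points. In the second family the extra singular point is kept on purpose: it is the
node or the third cusp.

Local types are recognised by completing a square or a cube over the ring of analytic germs
(`hasSingularityAt_a`, `hasSingularityAt_e6`). The arrows are obtained by restricting the four
families to lines in parameter space. -/

/-- An analytic germ that does not vanish has analytic roots of every positive order. -/
theorem exists_analyticAt_pow_eq {g : ℂ × ℂ → ℂ} {q : ℂ × ℂ} (hg : AnalyticAt ℂ g q)
    (h0 : g q ≠ 0) {n : ℕ} (hn : n ≠ 0) :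
    ∃ r : ℂ × ℂ → ℂ, AnalyticAt ℂ r q ∧ r q ≠ 0 ∧ ∀ᶠ p in 𝓝 q, r p ^ n = g p := by
  obtain ⟨a, ha⟩ := IsAlgClosed.exists_pow_nat_eq (g q) (Nat.pos_of_ne_zero hn)
  have ha0 : a ≠ 0 := by
    rintro rfl
    exact h0 (by rw [← ha, zero_pow hn])
  -- Dividing by the value at `q` puts the argument of the logarithm at `1`, away from the branch
  -- cut.
  have hlog : AnalyticAt ℂ (fun p => Complex.log (g p / g q)) q := by
    refine (hg.div analyticAt_const h0).clog ?_
    simp [div_self h0]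
  refine ⟨fun p => a * Complex.exp (Complex.log (g p / g q) / n),
    analyticAt_const.mul ((hlog.div analyticAt_const (by exact_mod_cast hn)).cexp'),
    mul_ne_zero ha0 (Complex.exp_ne_zero _), ?_⟩
  filter_upwards [hg.continuousAt.eventually_ne h0] with p hp
  have hn' : (n : ℂ) ≠ 0 := by exact_mod_cast hn
  rw [mul_pow, ha, ← Complex.exp_nat_mul, mul_div_cancel₀ _ hn',
    Complex.exp_log (div_ne_zero hp h0), mul_div_cancel₀ _ h0]

/-! ### Local coordinates and recognition of singularity types -/

/-- `u, v` are local analytic coordinates of the plane centred at `q`. -/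
structure IsCoords (u v : ℂ × ℂ → ℂ) (q : ℂ × ℂ) : Prop where
  left : AnalyticAt ℂ u q
  right : AnalyticAt ℂ v q
  left_eq : u q = 0
  right_eq : v q = 0
  det_ne : fderiv ℂ u q (1, 0) * fderiv ℂ v q (0, 1) -
    fderiv ℂ u q (0, 1) * fderiv ℂ v q (1, 0) ≠ 0

namespace IsCoords

variable {u v : ℂ × ℂ → ℂ} {q : ℂ × ℂ}

theorem swap (h : IsCoords u v q) : IsCoords v u q :=
  ⟨h.right, h.left, h.right_eq, h.left_eq, fun h0 => h.det_ne (by linear_combination -h0)⟩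

theorem mul_left (h : IsCoords u v q) {A : ℂ × ℂ → ℂ} (hA : AnalyticAt ℂ A q) (hA0 : A q ≠ 0) :
    IsCoords (fun p => A p * u p) v q := by
  have hd : fderiv ℂ (fun p => A p * u p) q = A q • fderiv ℂ u q := by
    rw [fderiv_fun_mul hA.differentiableAt h.left.differentiableAt, h.left_eq]
    ext <;> simp
  refine ⟨hA.mul h.left, h.right, by simp [h.left_eq], h.right_eq, ?_⟩
  rw [hd]
  simp only [smul_apply, smul_eq_mul]
  intro h0
  refine mul_ne_zero hA0 h.det_ne ?_
  linear_combination h0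

theorem mul_right (h : IsCoords u v q) {A : ℂ × ℂ → ℂ} (hA : AnalyticAt ℂ A q) (hA0 : A q ≠ 0) :
    IsCoords u (fun p => A p * v p) q :=
  (h.swap.mul_left hA hA0).swap

/-- Since `v` vanishes at `q` and `m ≥ 2`, the added term has zero differential there. -/
theorem add_mul_pow (h : IsCoords u v q) {A : ℂ × ℂ → ℂ} (hA : AnalyticAt ℂ A q) {m : ℕ}
    (hm : 2 ≤ m) : IsCoords (fun p => u p + A p * v p ^ m) v q := by
  have hvm : DifferentiableAt ℂ (fun p => v p ^ m) q := (h.right.pow m).differentiableAt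
  have hd : fderiv ℂ (fun p => u p + A p * v p ^ m) q = fderiv ℂ u q := by
    rw [fderiv_fun_add h.left.differentiableAt (hA.differentiableAt.fun_mul hvm),
      fderiv_fun_mul hA.differentiableAt hvm, fderiv_fun_pow _ h.right.differentiableAt, h.right_eq,
      zero_pow (by omega), zero_pow (by omega)]
    ext <;> simp
  refine ⟨h.left.add (hA.mul (h.right.pow m)), h.right, ?_, h.right_eq, ?_⟩
  · simp [h.left_eq, h.right_eq, show m ≠ 0 by omega]
  · rw [hd]
    exact h.det_ne

/-- Local coordinates have an analytic local inverse. -/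
theorem exists_inverse (h : IsCoords u v q) :
    ∃ Ψ : ℂ × ℂ → ℂ × ℂ, AnalyticAt ℂ Ψ 0 ∧ Ψ 0 = q ∧ Function.Injective (fderiv ℂ Ψ 0) ∧
      ∀ᶠ p in 𝓝 (0 : ℂ × ℂ), (u (Ψ p), v (Ψ p)) = p := by
  set G : ℂ × ℂ → ℂ × ℂ := fun p => (u p, v p) with hG
  have hGa : AnalyticAt ℂ G q := h.left.prod h.right
  have hGq : G q = 0 := by simp [hG, h.left_eq, h.right_eq]
  have hGd : fderiv ℂ G q = (fderiv ℂ u q).prod (fderiv ℂ v q) :=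
    h.left.differentiableAt.fderiv_prodMk h.right.differentiableAt
  have hinj : Function.Injective (fderiv ℂ G q : ℂ × ℂ →ₗ[ℂ] ℂ × ℂ) := by
    rw [← LinearMap.ker_eq_bot, LinearMap.ker_eq_bot']
    rintro ⟨x, y⟩ hxy
    have key : ∀ L : ℂ × ℂ →L[ℂ] ℂ, L (x, y) = x * L (1, 0) + y * L (0, 1) := by
      intro L
      rw [show ((x, y) : ℂ × ℂ) = x • (1, 0) + y • (0, 1) by simp, map_add, map_smul, map_smul]
      simp
    rw [hGd] at hxy
    simp only [ContinuousLinearMap.coe_coe, ContinuousLinearMap.prod_apply, Prod.mk_eq_zero,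
      key] at hxy
    obtain ⟨h1, h2⟩ := hxy
    have hx : x = 0 := (mul_eq_zero.1 (show x * _ = 0 by
      linear_combination (fderiv ℂ v q (0, 1)) * h1 - (fderiv ℂ u q (0, 1)) * h2)).resolve_right
        h.det_ne
    have hy : y = 0 := (mul_eq_zero.1 (show y * _ = 0 by
      linear_combination (fderiv ℂ u q (1, 0)) * h2 - (fderiv ℂ v q (1, 0)) * h1)).resolve_right
        h.det_ne
    simp [hx, hy]
  let e : (ℂ × ℂ) ≃L[ℂ] ℂ × ℂ := (LinearEquiv.ofInjectiveEndo _ hinj).toContinuousLinearEquiv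
  have he : HasFDerivAt G (e : ℂ × ℂ →L[ℂ] ℂ × ℂ) q := hGa.differentiableAt.hasFDerivAt
  -- The exponent `⊤` of `WithTop ℕ∞` means analyticity, so the inverse function theorem returns an
  -- analytic inverse.
  have hc : ContDiffAt ℂ ⊤ G q := hGa.contDiffAt
  have hn : (⊤ : WithTop ℕ∞) ≠ 0 := by simp
  have hs := hc.hasStrictFDerivAt' he hn
  refine ⟨hc.localInverse he hn, ?_, ?_, ?_, ?_⟩
  · rw [← hGq]
    exact (hc.to_localInverse he hn).analyticAt
  · rw [← hGq]
    exact hc.localInverse_apply_image he hn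
  · have := hs.to_localInverse.hasFDerivAt.fderiv
    rw [hGq] at this
    rw [ContDiffAt.localInverse, this]
    exact e.symm.injective
  · rw [← hGq]
    exact hs.eventually_right_inverse

end IsCoords

/-- Recognition of a singularity type in an affine chart `p ↦ [w + p.1 e₁ + p.2 e₂]`. -/
theorem hasSingularityAt_of_coords {F : MvPolynomial (Fin 3) ℂ} {P : P2} {τ : SingularityType}
    {w e₁ e₂ : Fin 3 → ℂ} (hli : LinearIndependent ℂ ![w, e₁, e₂]) {q : ℂ × ℂ}
    (hP : w + q.1 • e₁ + q.2 • e₂ ∈ P.submodule) {u v h : ℂ × ℂ → ℂ} (huv : IsCoords u v q)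
    (hh : AnalyticAt ℂ h q) (hq : h q ≠ 0)
    (hF : ∀ᶠ p in 𝓝 q,
      MvPolynomial.eval (w + p.1 • e₁ + p.2 • e₂) F = h p * τ.normalForm (u p, v p)) :
    HasSingularityAt F P τ := by
  obtain ⟨Ψ, hΨ, hΨ0, hΨi, hΨe⟩ := huv.exists_inverse
  have hA : ∀ p : ℂ × ℂ, HasFDerivAt (fun p : ℂ × ℂ => w + p.1 • e₁ + p.2 • e₂)
      ((ContinuousLinearMap.fst ℂ ℂ ℂ).smulRight e₁ +
        (ContinuousLinearMap.snd ℂ ℂ ℂ).smulRight e₂) p := fun p =>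
    (((ContinuousLinearMap.fst ℂ ℂ ℂ).smulRight e₁).hasFDerivAt.const_add w).add
      ((ContinuousLinearMap.snd ℂ ℂ ℂ).smulRight e₂).hasFDerivAt
  have hd : ∀ x, fderiv ℂ (fun p => w + (Ψ p).1 • e₁ + (Ψ p).2 • e₂) 0 x =
      (fderiv ℂ Ψ 0 x).1 • e₁ + (fderiv ℂ Ψ 0 x).2 • e₂ := by
    intro x
    have := ((hA (Ψ 0)).comp (0 : ℂ × ℂ) hΨ.differentiableAt.hasFDerivAt).fderiv
    rw [show (fun p => w + (Ψ p).1 • e₁ + (Ψ p).2 • e₂) =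
      (fun p : ℂ × ℂ => w + p.1 • e₁ + p.2 • e₂) ∘ Ψ from rfl, this]
    simp
  have hΨc : Tendsto Ψ (𝓝 0) (𝓝 q) := hΨ0 ▸ hΨ.continuousAt.tendsto
  refine ⟨fun p => w + (Ψ p).1 • e₁ + (Ψ p).2 • e₂, h ∘ Ψ, ?_, ?_, ?_, ?_, ?_, ?_⟩
  · have h1 : AnalyticAt ℂ (fun p => (Ψ p).1) 0 :=
      (ContinuousLinearMap.fst ℂ ℂ ℂ).analyticAt _ |>.comp hΨ
    have h2 : AnalyticAt ℂ (fun p => (Ψ p).2) 0 :=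
      (ContinuousLinearMap.snd ℂ ℂ ℂ).analyticAt _ |>.comp hΨ
    exact (analyticAt_const.add (h1.smul analyticAt_const)).add (h2.smul analyticAt_const)
  · exact AnalyticAt.comp (by rwa [hΨ0]) hΨ
  · simpa [hΨ0] using hq
  · simpa [hΨ0] using hP
  -- A relation among the three vectors is rewritten in `w, e₁, e₂`: the coefficient of `w` kills `g
  -- 0`, and then `(g 1, g 2)` lies in the kernel of the injective differential of `Ψ`.
  · rw [Fintype.linearIndependent_iff] at hli ⊢
    intro g hg
    set a := fderiv ℂ Ψ 0 (1, 0) with ha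
    set b := fderiv ℂ Ψ 0 (0, 1) with hb
    simp only [Fin.sum_univ_three, Matrix.cons_val, hd, hΨ0, ← ha, ← hb] at hg
    have := hli ![g 0, g 0 * q.1 + g 1 * a.1 + g 2 * b.1, g 0 * q.2 + g 1 * a.2 + g 2 * b.2] (by
      rw [← hg]
      simp only [Fin.sum_univ_three, Matrix.cons_val]
      module)
    have h0 : g 0 = 0 := this 0
    have h1 : g 0 * q.1 + g 1 * a.1 + g 2 * b.1 = 0 := this 1
    have h2 : g 0 * q.2 + g 1 * a.2 + g 2 * b.2 = 0 := this 2
    have h3 : fderiv ℂ Ψ 0 (g 1, g 2) = 0 := by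
      rw [show ((g 1, g 2) : ℂ × ℂ) = g 1 • (1, 0) + g 2 • (0, 1) by simp, map_add, map_smul,
        map_smul, ← ha, ← hb]
      ext
      · simpa [h0] using h1
      · simpa [h0] using h2
    have h4 : ((g 1, g 2) : ℂ × ℂ) = 0 := hΨi (by rw [h3, map_zero])
    simp only [Prod.mk_eq_zero] at h4
    intro i
    fin_cases i
    exacts [h0, h4.1, h4.2]
  · filter_upwards [hΨc.eventually hF, hΨe] with p hp hpe
    rw [hp, hpe]
    rfl

/-- Completing the square. -/
theorem hasSingularityAt_a {F : MvPolynomial (Fin 3) ℂ} {P : P2} {n m : ℕ}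
    {w e₁ e₂ : Fin 3 → ℂ} (hli : LinearIndependent ℂ ![w, e₁, e₂]) {q : ℂ × ℂ}
    (hP : w + q.1 • e₁ + q.2 • e₂ ∈ P.submodule) {u v A B D : ℂ × ℂ → ℂ} (huv : IsCoords u v q)
    (hA : AnalyticAt ℂ A q) (hB : AnalyticAt ℂ B q) (hD : AnalyticAt ℂ D q)
    (hA0 : A q ≠ 0) (hD0 : D q ≠ 0) (hm : 2 ≤ m) (hnm : n + 1 < 2 * m)
    (hF : ∀ᶠ p in 𝓝 q, MvPolynomial.eval (w + p.1 • e₁ + p.2 • e₂) F =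
      A p * u p ^ 2 + B p * u p * v p ^ m + D p * v p ^ (n + 1)) :
    HasSingularityAt F P (.a n) := by
  -- Replacing `u` by `u + (B / 2A) vᵐ` costs a term in `v ^ (2m)`. As `2m > n + 1`, it is absorbed
  -- in the coefficient of `v ^ (n + 1)` without changing its value at `q`.
  obtain ⟨k, hk⟩ : ∃ k, 2 * m = n + 1 + (k + 1) := ⟨2 * m - n - 2, by omega⟩
  have hE : AnalyticAt ℂ (fun p => B p / (2 * A p)) q :=
    hB.div (analyticAt_const.mul hA) (mul_ne_zero two_ne_zero hA0)
  have hD' : AnalyticAt ℂ (fun p => D p - A p * (B p / (2 * A p)) ^ 2 * v p ^ (k + 1)) q :=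
    hD.sub ((hA.mul (hE.pow 2)).mul (huv.right.pow _))
  obtain ⟨r, hr, hr0, hre⟩ := exists_analyticAt_pow_eq hA hA0 two_ne_zero
  obtain ⟨s, hs, hs0, hse⟩ := exists_analyticAt_pow_eq hD' (by simpa [huv.right_eq] using hD0)
    n.succ_ne_zero
  refine hasSingularityAt_of_coords hli hP
    (((huv.add_mul_pow hE hm).mul_left hr hr0).mul_right hs hs0) (h := fun _ => 1)
    analyticAt_const one_ne_zero ?_
  filter_upwards [hF, hre, hse, hA.continuousAt.eventually_ne hA0] with p hp hrp hsp hAp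
  rw [hp]
  simp only [SingularityType.normalForm, mul_pow, hrp, hsp, one_mul]
  have : v p ^ (2 * m) = v p ^ (n + 1) * v p ^ (k + 1) := by rw [hk, pow_add]
  rw [add_sq, mul_pow, ← pow_mul, mul_comm m 2, this]
  field_simp
  ring

/-- Completing the cube. -/
theorem hasSingularityAt_e6 {F : MvPolynomial (Fin 3) ℂ} {P : P2}
    {w e₁ e₂ : Fin 3 → ℂ} (hli : LinearIndependent ℂ ![w, e₁, e₂]) {q : ℂ × ℂ}
    (hP : w + q.1 • e₁ + q.2 • e₂ ∈ P.submodule) {u v A B D : ℂ × ℂ → ℂ} (huv : IsCoords u v q)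
    (hA : AnalyticAt ℂ A q) (hB : AnalyticAt ℂ B q) (hD : AnalyticAt ℂ D q)
    (hA0 : A q ≠ 0) (hD0 : D q ≠ 0)
    (hF : ∀ᶠ p in 𝓝 q, MvPolynomial.eval (w + p.1 • e₁ + p.2 • e₂) F =
      A p * u p ^ 3 + B p * u p ^ 2 * v p ^ 2 + D p * v p ^ 4) :
    HasSingularityAt F P .e6 := by
  have hE : AnalyticAt ℂ (fun p => B p / (3 * A p)) q :=
    hB.div (analyticAt_const.mul hA) (mul_ne_zero three_ne_zero hA0)
  -- With `E = B / 3A`, the cube `A (u + E v²)³` also produces `3 A E² u v⁴ + A E³ v⁶`; both are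
  -- multiples of `v⁴` whose cofactors vanish at `q`.
  have hD' : AnalyticAt ℂ (fun p => D p - 3 * A p * (B p / (3 * A p)) ^ 2 * u p -
      A p * (B p / (3 * A p)) ^ 3 * v p ^ 2) q :=
    (hD.sub (((analyticAt_const.mul hA).mul (hE.pow 2)).mul huv.left)).sub
      ((hA.mul (hE.pow 3)).mul (huv.right.pow _))
  obtain ⟨r, hr, hr0, hre⟩ := exists_analyticAt_pow_eq hA hA0 three_ne_zero
  obtain ⟨s, hs, hs0, hse⟩ := exists_analyticAt_pow_eq hD'
    (by simpa [huv.right_eq, huv.left_eq] using hD0) four_ne_zero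
  refine hasSingularityAt_of_coords hli hP
    (((huv.add_mul_pow hE le_rfl).mul_left hr hr0).mul_right hs hs0) (h := fun _ => 1)
    analyticAt_const one_ne_zero ?_
  filter_upwards [hF, hre, hse, hA.continuousAt.eventually_ne hA0] with p hp hrp hsp hAp
  rw [hp]
  simp only [SingularityType.normalForm, mul_pow, hrp, hsp, one_mul]
  field_simp
  ring

/-! ### The quartics `q² + c² X³ Z` and their singular points -/

/-- The ternary quadratic form with coefficients `k` of `X², XY, Y², XZ, YZ, Z²`. -/
def conicEval (k : Fin 6 → ℂ) (x y z : ℂ) : ℂ :=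
  k 0 * x ^ 2 + k 1 * x * y + k 2 * y ^ 2 + k 3 * x * z + k 4 * y * z + k 5 * z ^ 2

open MvPolynomial in
/-- The ternary quadratic form `conicEval k` as a polynomial. -/
noncomputable def conic (k : Fin 6 → ℂ) : MvPolynomial (Fin 3) ℂ :=
  C (k 0) * X 0 ^ 2 + C (k 1) * (X 0 * X 1) + C (k 2) * X 1 ^ 2 + C (k 3) * (X 0 * X 2) +
    C (k 4) * (X 1 * X 2) + C (k 5) * X 2 ^ 2

open MvPolynomial in
/-- The quartic `q² + c² X³ Z`, where `q` is the quadratic form with coefficients `k`. -/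
noncomputable def quartic (k : Fin 6 → ℂ) (c : ℂ) : MvPolynomial (Fin 3) ℂ :=
  conic k ^ 2 + C (c ^ 2) * (X 0 ^ 3 * X 2)

theorem eval_quartic (k : Fin 6 → ℂ) (c : ℂ) (v : Fin 3 → ℂ) :
    MvPolynomial.eval v (quartic k c) =
      conicEval k (v 0) (v 1) (v 2) ^ 2 + c ^ 2 * v 0 ^ 3 * v 2 := by
  simp [quartic, conic, conicEval]
  ring

theorem isHomogeneous_quartic (k : Fin 6 → ℂ) (c : ℂ) : (quartic k c).IsHomogeneous 4 := by
  have hX : ∀ i : Fin 3, (MvPolynomial.X i : MvPolynomial (Fin 3) ℂ).IsHomogeneous 1 :=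
    MvPolynomial.isHomogeneous_X ℂ
  have h2 : ∀ i j : Fin 3, (MvPolynomial.X i * MvPolynomial.X j :
      MvPolynomial (Fin 3) ℂ).IsHomogeneous 2 := fun i j => (hX i).mul (hX j)
  have hs : ∀ i : Fin 3, (MvPolynomial.X i ^ 2 : MvPolynomial (Fin 3) ℂ).IsHomogeneous 2 :=
    fun i => (hX i).pow 2
  have hq : (conic k).IsHomogeneous 2 :=
    ((((((hs 0).C_mul _).add ((h2 0 1).C_mul _)).add ((hs 1).C_mul _)).add
      ((h2 0 2).C_mul _)).add ((h2 1 2).C_mul _)).add ((hs 2).C_mul _)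
  exact (hq.pow 2).add ((((hX 0).pow 3).mul (hX 2)).C_mul _)

/-- The equations of the singular points of `quartic k c`. -/
def IsSingular (k : Fin 6 → ℂ) (c x y z : ℂ) : Prop :=
  conicEval k x y z ^ 2 + c ^ 2 * x ^ 3 * z = 0 ∧
  2 * conicEval k x y z * (2 * k 0 * x + k 1 * y + k 3 * z) + 3 * c ^ 2 * x ^ 2 * z = 0 ∧
  2 * conicEval k x y z * (k 1 * x + 2 * k 2 * y + k 4 * z) = 0 ∧
  2 * conicEval k x y z * (k 3 * x + k 4 * y + 2 * k 5 * z) + c ^ 2 * x ^ 3 = 0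

theorem isSingular_smul {k : Fin 6 → ℂ} {c x y z a : ℂ} (ha : a ≠ 0) :
    IsSingular k c (a * x) (a * y) (a * z) ↔ IsSingular k c x y z := by
  have h : conicEval k (a * x) (a * y) (a * z) = a ^ 2 * conicEval k x y z := by
    unfold conicEval
    ring
  have key : ∀ {n : ℕ} {s t : ℂ}, s = a ^ n * t → (s = 0 ↔ t = 0) := by
    rintro n s t rfl
    simp [ha]
  refine and_congr (key (n := 4) ?_) (and_congr (key (n := 3) ?_)
    (and_congr (key (n := 3) ?_) (key (n := 3) ?_))) <;> rw [h] <;> ring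

theorem exists_rep_mk_eq (v : Fin 3 → ℂ) (hv : v ≠ 0) :
    ∃ a : ℂ, a ≠ 0 ∧ (Projectivization.mk ℂ v hv : P2).rep = a • v := by
  obtain ⟨a, ha⟩ := Projectivization.exists_smul_eq_mk_rep ℂ v hv
  exact ⟨a, a.ne_zero, ha.symm⟩

theorem mk_mem_lineAtInfinity {v : Fin 3 → ℂ} {hv : v ≠ 0} :
    Projectivization.mk ℂ v hv ∈ lineAtInfinity ↔ v 2 = 0 := by
  obtain ⟨a, ha, h⟩ := exists_rep_mk_eq v hv
  simp [lineAtInfinity, h, ha]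

theorem mk_mem_curve_quartic {k : Fin 6 → ℂ} {c : ℂ} {v : Fin 3 → ℂ} {hv : v ≠ 0} :
    Projectivization.mk ℂ v hv ∈ curve (quartic k c) ↔
      conicEval k (v 0) (v 1) (v 2) ^ 2 + c ^ 2 * v 0 ^ 3 * v 2 = 0 := by
  obtain ⟨a, ha, h⟩ := exists_rep_mk_eq v hv
  have : MvPolynomial.eval (a • v) (quartic k c) =
      a ^ 4 * (conicEval k (v 0) (v 1) (v 2) ^ 2 + c ^ 2 * v 0 ^ 3 * v 2) := by
    rw [eval_quartic]
    simp only [Pi.smul_apply, smul_eq_mul, conicEval]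
    ring
  simp [curve, h, this, ha]

theorem mk_mem_singularLocus_quartic {k : Fin 6 → ℂ} {c : ℂ} {v : Fin 3 → ℂ} {hv : v ≠ 0} :
    Projectivization.mk ℂ v hv ∈ singularLocus (quartic k c) ↔
      IsSingular k c (v 0) (v 1) (v 2) := by
  obtain ⟨a, ha, h⟩ := exists_rep_mk_eq v hv
  rw [← isSingular_smul ha]
  simp only [singularLocus, curve, Set.mem_ofPred_eq, h, eval_quartic, Fin.forall_fin_succ,
    Pi.smul_apply, smul_eq_mul, IsSingular]
  refine and_congr Iff.rfl ?_
  simp only [Fin.succ_zero_eq_one, Fin.succ_one_eq_two, IsEmpty.forall_iff, and_true]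
  refine and_congr ?_ (and_congr ?_ ?_) <;> refine Eq.congr_left ?_ <;>
    simp [quartic, conic, conicEval, MvPolynomial.pderiv_X] <;> ring

/-! ### Points of the plane and singularity conditions on each stratum -/

/-- The point `[x : y : 1]`. -/
noncomputable def affinePoint (x y : ℂ) : P2 :=
  .mk ℂ ![x, y, 1] fun h => one_ne_zero (congrFun h 2)

/-- The point `[1 : t : 0]`. -/
noncomputable def infinitePoint (t : ℂ) : P2 :=
  .mk ℂ ![1, t, 0] fun h => one_ne_zero (congrFun h 0)

/-- The point `[0 : 1 : 0]`. -/
noncomputable def verticalPoint : P2 :=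
  .mk ℂ ![0, 1, 0] fun h => one_ne_zero (congrFun h 1)

theorem P2_cases (P : P2) :
    (∃ x y, P = affinePoint x y) ∨ (∃ t, P = infinitePoint t) ∨ P = verticalPoint := by
  induction P using Projectivization.ind with
  | h v hv =>
    by_cases h2 : v 2 = 0
    · by_cases h0 : v 0 = 0
      · have h1 : v 1 ≠ 0 := by
          intro h1
          refine hv (funext fun i => ?_)
          fin_cases i <;> assumption
        refine .inr (.inr ((Projectivization.mk_eq_mk_iff' ..).2 ⟨v 1, ?_⟩))
        ext i
        fin_cases i <;> simp [h0, h2]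
      · refine .inr (.inl ⟨v 1 / v 0, (Projectivization.mk_eq_mk_iff' ..).2 ⟨v 0, ?_⟩⟩)
        ext i
        fin_cases i <;> simp [h2]
        field_simp
    · refine .inl ⟨v 0 / v 2, v 1 / v 2, (Projectivization.mk_eq_mk_iff' ..).2 ⟨v 2, ?_⟩⟩
      ext i
      fin_cases i <;> simp <;> field_simp

@[simp]
theorem affinePoint_inj {x y x' y' : ℂ} :
    affinePoint x y = affinePoint x' y' ↔ x = x' ∧ y = y' := by
  refine ⟨fun h => ?_, by rintro ⟨rfl, rfl⟩; rfl⟩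
  obtain ⟨a, ha⟩ := (Projectivization.mk_eq_mk_iff' ..).1 h
  have h0 := congrFun ha 0
  have h1 := congrFun ha 1
  have h2 : a = 1 := by simpa using congrFun ha 2
  subst h2
  simp at h0 h1
  exact ⟨h0.symm, h1.symm⟩

@[simp]
theorem affinePoint_notMem_lineAtInfinity {x y : ℂ} : affinePoint x y ∉ lineAtInfinity := by
  simp [affinePoint, mk_mem_lineAtInfinity]

@[simp]
theorem infinitePoint_mem_lineAtInfinity {t : ℂ} : infinitePoint t ∈ lineAtInfinity := by
  simp [infinitePoint, mk_mem_lineAtInfinity]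

@[simp]
theorem verticalPoint_mem_lineAtInfinity : verticalPoint ∈ lineAtInfinity := by
  simp [verticalPoint, mk_mem_lineAtInfinity]

@[simp]
theorem infinitePoint_inj {t t' : ℂ} : infinitePoint t = infinitePoint t' ↔ t = t' := by
  refine ⟨fun h => ?_, by rintro rfl; rfl⟩
  obtain ⟨a, ha⟩ := (Projectivization.mk_eq_mk_iff' ..).1 h
  have h0 : a = 1 := by simpa using congrFun ha 0
  have h1 := congrFun ha 1
  subst h0
  simpa using h1.symm

@[simp]
theorem infinitePoint_ne_verticalPoint {t : ℂ} : infinitePoint t ≠ verticalPoint := by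
  intro h
  obtain ⟨a, ha⟩ := (Projectivization.mk_eq_mk_iff' ..).1 h
  simpa using congrFun ha 0

@[simp]
theorem affinePoint_ne_verticalPoint {x y : ℂ} : affinePoint x y ≠ verticalPoint := fun h =>
  affinePoint_notMem_lineAtInfinity (h ▸ verticalPoint_mem_lineAtInfinity)

@[simp]
theorem affinePoint_ne_infinitePoint {x y t : ℂ} : affinePoint x y ≠ infinitePoint t := fun h =>
  affinePoint_notMem_lineAtInfinity (h ▸ infinitePoint_mem_lineAtInfinity)

section

variable {k : Fin 6 → ℂ} {c : ℂ}

theorem infinitePoint_mem_curve {t : ℂ} :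
    infinitePoint t ∈ curve (quartic k c) ↔ k 0 + k 1 * t + k 2 * t ^ 2 = 0 := by
  simp [infinitePoint, mk_mem_curve_quartic, conicEval]

theorem verticalPoint_mem_curve : verticalPoint ∈ curve (quartic k c) ↔ k 2 = 0 := by
  simp [verticalPoint, mk_mem_curve_quartic, conicEval]

/-- On `Z = 0` the equation forces `q = 0`, and the `Z`-derivative is then `c² X³`, which is nonzero
away from `[0 : 1 : 0]`. -/
theorem infinitePoint_notMem_singularLocus (hc : c ≠ 0) {t : ℂ} :
    infinitePoint t ∉ singularLocus (quartic k c) := by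
  rw [infinitePoint, mk_mem_singularLocus_quartic]
  rintro ⟨h1, -, -, h2⟩
  simp at h1 h2
  simp [h1, hc] at h2

theorem verticalPoint_mem_singularLocus :
    verticalPoint ∈ singularLocus (quartic k c) ↔ k 2 = 0 := by
  rw [verticalPoint, mk_mem_singularLocus_quartic]
  simp [IsSingular, conicEval]
  tauto

/-- The conditions on an affine singular point of `quartic k c` outside the conic: with
`x = -τ²`, the conic has the value `c τ³` there and satisfies two equations of degree one. -/
def IsExtraSingular (k : Fin 6 → ℂ) (c x y : ℂ) : Prop :=
  ∃ τ : ℂ, τ ≠ 0 ∧ x = -τ ^ 2 ∧ conicEval k x y 1 = c * τ ^ 3 ∧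
    2 * (2 * k 0 * x + k 1 * y + k 3) + 3 * c * τ = 0 ∧ k 1 * x + 2 * k 2 * y + k 4 = 0

theorem affinePoint_mem_singularLocus (hc : c ≠ 0) {x y : ℂ} :
    affinePoint x y ∈ singularLocus (quartic k c) ↔
      (x = 0 ∧ k 2 * y ^ 2 + k 4 * y + k 5 = 0) ∨ IsExtraSingular k c x y := by
  rw [affinePoint, mk_mem_singularLocus_quartic]
  simp only [Matrix.cons_val]
  constructor
  · rintro ⟨h1, h2, h3, h4⟩
    by_cases hx : x = 0
    · left
      subst hx
      refine ⟨rfl, ?_⟩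
      simpa [conicEval] using h1
    · right
      have hq : conicEval k x y 1 ≠ 0 := by
        intro hq
        rw [hq] at h1
        simp [hc, hx] at h1
      -- This is the parameter of the cuspidal cubic `q² = -c² x³`, recovered from `x = -τ²` and `q
      -- = c τ³`.
      refine ⟨-conicEval k x y 1 / (c * x), ?_, ?_, ?_, ?_, ?_⟩
      · simp [hq, hc, hx]
      · field_simp
        linear_combination h1
      · field_simp
        linear_combination h1
      · field_simp
        have : conicEval k x y 1 * (2 * (2 * k 0 * x + k 1 * y + k 3) * x -
            3 * conicEval k x y 1) = 0 := by linear_combination x * h2 - 3 * h1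
        linear_combination (mul_eq_zero.1 this).resolve_left hq
      · have := (mul_eq_zero.1 h3).resolve_left (mul_ne_zero two_ne_zero hq)
        linear_combination this
  · rintro (⟨rfl, h⟩ | ⟨τ, hτ, hx, h1, h2, h3⟩)
    · have hq : conicEval k 0 y 1 = 0 := by
        unfold conicEval
        linear_combination h
      simp [IsSingular, hq]
    -- Euler's relation for the conic; it supplies the `Z`-derivative, which the conditions on `τ`
    -- leave out.
    · have hq : 2 * conicEval k x y 1 = k 3 * x + k 4 * y + 2 * k 5 +
          x * (2 * k 0 * x + k 1 * y + k 3) + y * (k 1 * x + 2 * k 2 * y + k 4) := by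
        unfold conicEval
        ring
      refine ⟨?_, ?_, ?_, ?_⟩
      · rw [h1, hx]
        ring
      · rw [h1, hx]
        rw [hx] at h2
        linear_combination c * τ ^ 3 * h2
      · rw [mul_one, h3, mul_zero]
      · rw [h1] at hq ⊢
        rw [hx] at hq h2 h3 ⊢
        linear_combination -2 * c * τ ^ 3 * hq + τ ^ 5 * c * h2 - 2 * c * τ ^ 3 * y * h3

/-! ### Position relative to the line at infinity -/

/-- A polynomial `Xⁿ g` with `g 0 ≠ 0` has order `n` at the origin. -/
theorem rootMultiplicity_zero_X_pow_mul {n : ℕ} {g : Polynomial ℂ} (hg : g.eval 0 ≠ 0) :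
    Polynomial.rootMultiplicity 0 (Polynomial.X ^ n * g) = n := by
  have hg0 : g ≠ 0 := by
    rintro rfl
    simp at hg
  have h := Polynomial.rootMultiplicity_mul_X_sub_C_pow (n := n) (a := (0 : ℂ)) hg0
  rw [Polynomial.rootMultiplicity_eq_zero hg] at h
  simpa [mul_comm] using h

-- The quartic restricts to `q²` on `Z = 0`, so its intersection multiplicities are twice those of
-- the conic. The factorisation is asked for the conic only, along an arbitrary transversal
-- direction `(V0, V1)`.
open Polynomial in
theorem meetsInfinityWithMult_of_factor {v : Fin 3 → ℂ} {hv : v ≠ 0} (hv2 : v 2 = 0) {m : ℕ}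
    (h : ∀ a V0 V1 : ℂ, a ≠ 0 → v 0 * V1 - v 1 * V0 ≠ 0 → ∃ g : Polynomial ℂ, g.eval 0 ≠ 0 ∧
      C (k 0) * (C (a * v 0) + C V0 * X) ^ 2 +
        C (k 1) * (C (a * v 0) + C V0 * X) * (C (a * v 1) + C V1 * X) +
        C (k 2) * (C (a * v 1) + C V1 * X) ^ 2 = X ^ m * g) :
    MeetsInfinityWithMult (quartic k c) (.mk ℂ v hv) (2 * m) := by
  intro V hV hli
  obtain ⟨a, ha, hr⟩ := exists_rep_mk_eq v hv
  rw [hr] at hli ⊢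
  have hdet : v 0 * V 1 - v 1 * V 0 ≠ 0 := by
    intro h0
    rw [LinearIndependent.pair_iff] at hli
    have h1 := (hli (V 0) (-(a * v 0)) (by
      ext j
      fin_cases j
      · simp
        ring
      · simp
        linear_combination -a * h0
      · simp [hv2, hV])).2
    have h2 := (hli (V 1) (-(a * v 1)) (by
      ext j
      fin_cases j
      · simp
        linear_combination a * h0
      · simp
        ring
      · simp [hv2, hV])).2
    simp only [neg_eq_zero, mul_eq_zero, ha, false_or] at h1 h2
    refine hv (funext fun j => ?_)
    fin_cases j <;> assumption
  obtain ⟨g, hg, he⟩ := h a (V 0) (V 1) ha hdet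
  have : MvPolynomial.aeval (fun i => C ((a • v) i) + C (V i) * X) (quartic k c) =
      X ^ (2 * m) * g ^ 2 := by
    rw [pow_mul', ← mul_pow, ← he]
    simp [quartic, conic, hv2, hV, Polynomial.algebraMap_eq]
    ring
  rw [this]
  exact rootMultiplicity_zero_X_pow_mul (by simpa using hg)

end

section

variable {k : Fin 6 → ℂ} {c : ℂ}

open Polynomial in
theorem position_i (hc : c ≠ 0) {t₁ t₂ : ℂ} (h2 : k 2 ≠ 0) (ht : t₁ ≠ t₂)
    (h0 : k 0 = k 2 * t₁ * t₂) (h1 : k 1 = -k 2 * (t₁ + t₂)) : Position.i.Holds (quartic k c) := by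
  have hm : ∀ {t t' : ℂ}, t ≠ t' → k 0 = k 2 * t * t' → k 1 = -k 2 * (t + t') →
      MeetsInfinityWithMult (quartic k c) (infinitePoint t) 2 := by
    intro t t' ht h0 h1
    -- The conic on `Z = 0` is `k 2 (Y - t X)(Y - t' X)`. Along the parametrised line the first
    -- factor becomes `(V1 - t V0) x`, while the second keeps the nonzero constant term `a (t -
    -- t')`.
    refine meetsInfinityWithMult_of_factor (m := 1) rfl fun a V0 V1 ha hV =>
      ⟨C (k 2 * (V1 - t * V0)) * (C (a * (t - t')) + C (V1 - t' * V0) * X), ?_, ?_⟩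
    · simp only [Matrix.cons_val, one_mul] at hV
      simp [h2, ha, sub_ne_zero.2 ht, hV]
    · simp [h0, h1]
      ring
  refine ⟨infinitePoint t₁, infinitePoint t₂, by simpa using ht, ?_,
    infinitePoint_notMem_singularLocus hc, hm ht h0 h1, infinitePoint_notMem_singularLocus hc,
    hm ht.symm (by rw [h0]; ring) (by rw [h1]; ring)⟩
  ext P
  rcases P2_cases P with ⟨x, y, rfl⟩ | ⟨t, rfl⟩ | rfl
  · simp
  · have : k 0 + k 1 * t + k 2 * t ^ 2 = k 2 * ((t - t₁) * (t - t₂)) := by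
      rw [h0, h1]
      ring
    simp [infinitePoint_mem_curve, this, h2, sub_eq_zero]
  · simp [verticalPoint_mem_curve, h2, infinitePoint_ne_verticalPoint.symm]

open Polynomial in
theorem position_iv (hc : c ≠ 0) {t : ℂ} (h2 : k 2 ≠ 0) (h0 : k 0 = k 2 * t ^ 2)
    (h1 : k 1 = -2 * k 2 * t) : Position.iv.Holds (quartic k c) := by
  refine ⟨infinitePoint t, ?_, infinitePoint_notMem_singularLocus hc,
    meetsInfinityWithMult_of_factor (m := 2) rfl fun a V0 V1 ha hV =>
      ⟨C (k 2 * (V1 - t * V0) ^ 2), ?_, ?_⟩⟩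
  · ext P
    rcases P2_cases P with ⟨x, y, rfl⟩ | ⟨t', rfl⟩ | rfl
    · simp
    · have : k 0 + k 1 * t' + k 2 * t' ^ 2 = k 2 * (t' - t) ^ 2 := by
        rw [h0, h1]
        ring
      simp [infinitePoint_mem_curve, this, h2, sub_eq_zero]
    · simp [verticalPoint_mem_curve, h2, infinitePoint_ne_verticalPoint.symm]
  · simp only [Matrix.cons_val, one_mul] at hV
    simp [h2, hV]
  · simp only [h0, h1, Matrix.cons_val, mul_one, map_mul, map_neg, map_pow, map_sub, map_ofNat]
    ring

open Polynomial in
theorem position_ii (hc : c ≠ 0) {t : ℂ} (h2 : k 2 = 0) (h1 : k 1 ≠ 0) (h0 : k 0 = -k 1 * t) :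
    Position.ii.Holds (quartic k c) := by
  refine ⟨infinitePoint t, verticalPoint, infinitePoint_ne_verticalPoint, ?_,
    infinitePoint_notMem_singularLocus hc,
    meetsInfinityWithMult_of_factor (m := 1) rfl fun a V0 V1 ha hV =>
      ⟨C (V1 - t * V0) * (C (k 1 * a) + C (k 1 * V0) * X), ?_, ?_⟩,
    verticalPoint_mem_singularLocus.2 h2⟩
  · ext P
    rcases P2_cases P with ⟨x, y, rfl⟩ | ⟨t', rfl⟩ | rfl
    · simp
    · simp only [Set.mem_inter_iff, infinitePoint_mem_curve, h2, infinitePoint_mem_lineAtInfinity,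
        Set.mem_insert_iff, infinitePoint_inj, Set.mem_singleton_iff, infinitePoint_ne_verticalPoint,
        and_true, or_false]
      rw [show k 0 + k 1 * t' + 0 * t' ^ 2 = k 1 * (t' - t) by rw [h0]; ring]
      simp [h1, sub_eq_zero]
    · simp [verticalPoint_mem_curve, h2]
  · simp only [Matrix.cons_val, one_mul] at hV
    simp only [eval_mul, eval_C, eval_add, eval_X, mul_zero, add_zero]
    exact mul_ne_zero hV (mul_ne_zero h1 ha)
  · simp [h2, h0]
    ring

open Polynomial in
theorem position_v (h2 : k 2 = 0) (h1 : k 1 = 0) (h0 : k 0 ≠ 0) :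
    Position.v.Holds (quartic k c) := by
  refine ⟨verticalPoint, ?_, verticalPoint_mem_singularLocus.2 h2,
    meetsInfinityWithMult_of_factor (m := 2) rfl fun a V0 V1 ha hV =>
      ⟨C (k 0 * V0 ^ 2), ?_, ?_⟩⟩
  · ext P
    rcases P2_cases P with ⟨x, y, rfl⟩ | ⟨t, rfl⟩ | rfl
    · simp
    · simp [infinitePoint_mem_curve, h2, h1, h0]
    · simp [verticalPoint_mem_curve, h2]
  · simp only [Matrix.cons_val, zero_mul, one_mul, zero_sub, neg_ne_zero] at hV
    simp [h0, hV]
  · simp [h1, h2]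
    ring

end

/-! ### Local types -/

attribute [fun_prop] analyticAt_fst analyticAt_snd

theorem hasFDerivAt_conicEval (k : Fin 6 → ℂ) (q : ℂ × ℂ) :
    HasFDerivAt (fun p : ℂ × ℂ => conicEval k p.1 p.2 1)
      ((2 * k 0 * q.1 + k 1 * q.2 + k 3) • ContinuousLinearMap.fst ℂ ℂ ℂ +
        (k 1 * q.1 + 2 * k 2 * q.2 + k 4) • ContinuousLinearMap.snd ℂ ℂ ℂ) q := by
  have h1 : HasFDerivAt (fun p : ℂ × ℂ => p.1) (ContinuousLinearMap.fst ℂ ℂ ℂ) q := hasFDerivAt_fst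
  have h2 : HasFDerivAt (fun p : ℂ × ℂ => p.2) (ContinuousLinearMap.snd ℂ ℂ ℂ) q := hasFDerivAt_snd
  have := ((((((h1.mul h1).const_mul (k 0)).add ((h1.mul h2).const_mul (k 1))).add
    ((h2.mul h2).const_mul (k 2))).add (h1.const_mul (k 3))).add (h2.const_mul (k 4))).add
    (hasFDerivAt_const (k 5) q)
  convert! this using 1
  · ext p
    simp [conicEval]
    ring
  · ext <;> simp <;> ring

/-- The second coordinate is usually linear: as coefficient vectors, `![0, 0, 0, 1, 0, 0]` is the
first chart coordinate and `![0, 0, 0, 0, 1, 0]` the second. -/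
theorem isCoords_conicEval {k l : Fin 6 → ℂ} {q : ℂ × ℂ} (hk : conicEval k q.1 q.2 1 = 0)
    (hl : conicEval l q.1 q.2 1 = 0)
    (hdet : (2 * k 0 * q.1 + k 1 * q.2 + k 3) * (l 1 * q.1 + 2 * l 2 * q.2 + l 4) -
      (k 1 * q.1 + 2 * k 2 * q.2 + k 4) * (2 * l 0 * q.1 + l 1 * q.2 + l 3) ≠ 0) :
    IsCoords (fun p => conicEval k p.1 p.2 1) (fun p => conicEval l p.1 p.2 1) q := by
  have ha : ∀ k : Fin 6 → ℂ, AnalyticAt ℂ (fun p : ℂ × ℂ => conicEval k p.1 p.2 1) q := by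
    intro k
    unfold conicEval
    fun_prop
  refine ⟨ha k, ha l, hk, hl, ?_⟩
  rw [(hasFDerivAt_conicEval k q).fderiv, (hasFDerivAt_conicEval l q).fderiv]
  simpa using hdet

theorem linearIndependent_affine_chart :
    LinearIndependent ℂ ![(![0, 0, 1] : Fin 3 → ℂ), ![1, 0, 0], ![0, 1, 0]] := by
  rw [Fintype.linearIndependent_iff]
  intro g hg
  have h0 := congrFun hg 0
  have h1 := congrFun hg 1
  have h2 := congrFun hg 2
  simp [Fin.sum_univ_three] at h0 h1 h2
  intro i
  fin_cases i <;> assumption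

theorem linearIndependent_vertical_chart :
    LinearIndependent ℂ ![(![0, 1, 0] : Fin 3 → ℂ), ![1, 0, 0], ![0, 0, 1]] := by
  rw [Fintype.linearIndependent_iff]
  intro g hg
  have h0 := congrFun hg 0
  have h1 := congrFun hg 1
  have h2 := congrFun hg 2
  simp [Fin.sum_univ_three] at h0 h1 h2
  intro i
  fin_cases i <;> assumption

theorem eval_affine_chart (k : Fin 6 → ℂ) (c : ℂ) (p : ℂ × ℂ) :
    MvPolynomial.eval (![0, 0, 1] + p.1 • ![1, 0, 0] + p.2 • ![0, 1, 0]) (quartic k c) =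
      conicEval k p.1 p.2 1 ^ 2 + c ^ 2 * p.1 ^ 3 := by
  simp [eval_quartic]

theorem eval_vertical_chart (k : Fin 6 → ℂ) (c : ℂ) (p : ℂ × ℂ) :
    MvPolynomial.eval (![0, 1, 0] + p.1 • ![1, 0, 0] + p.2 • ![0, 0, 1]) (quartic k c) =
      conicEval ![k 0, k 3, k 5, k 1, k 4, k 2] p.1 p.2 1 ^ 2 + c ^ 2 * p.1 ^ 3 * p.2 := by
  simp [eval_quartic, conicEval]
  ring

theorem affine_chart_mem_submodule (q : ℂ × ℂ) :
    (![0, 0, 1] + q.1 • ![1, 0, 0] + q.2 • ![0, 1, 0] : Fin 3 → ℂ) ∈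
      (affinePoint q.1 q.2).submodule := by
  rw [affinePoint, Projectivization.submodule_mk]
  convert! Submodule.mem_span_singleton_self _ using 1
  ext i
  fin_cases i <;> simp

theorem vertical_chart_mem_submodule :
    (![0, 1, 0] + (0 : ℂ × ℂ).1 • ![1, 0, 0] + (0 : ℂ × ℂ).2 • ![0, 0, 1] : Fin 3 → ℂ) ∈
      verticalPoint.submodule := by
  rw [verticalPoint, Projectivization.submodule_mk]
  simp

theorem hasSingularityAt_cusp {k : Fin 6 → ℂ} {c y : ℂ} (hc : c ≠ 0)
    (hy : k 2 * y ^ 2 + k 4 * y + k 5 = 0) (hy' : 2 * k 2 * y + k 4 ≠ 0) :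
    HasSingularityAt (quartic k c) (affinePoint 0 y) (.a 2) := by
  refine hasSingularityAt_a (m := 3) (A := fun _ => 1) (B := fun _ => 0) (D := fun _ => c ^ 2)
    linearIndependent_affine_chart
    (affine_chart_mem_submodule (0, y)) (isCoords_conicEval (k := k) (l := ![0, 0, 0, 1, 0, 0])
      (by simpa [conicEval] using hy) (by simp [conicEval])
      (by simpa [← neg_add_rev] using hy'))
    analyticAt_const analyticAt_const analyticAt_const one_ne_zero (pow_ne_zero 2 hc) (by norm_num)
    (by norm_num) (.of_forall fun p => ?_)
  rw [eval_affine_chart]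
  simp [conicEval]

/-- A further singular point on the axis of symmetry of the conic `y² + a x² + b x + d`. -/
theorem hasSingularityAt_axis {a b d c x : ℂ} {n : ℕ} {D : Polynomial ℂ} (hn : n ≤ 2)
    (hD : ∀ z : ℂ, (a * z ^ 2 + b * z + d) ^ 2 + c ^ 2 * z ^ 3 = (z - x) ^ (n + 1) * D.eval z)
    (hDx : D.eval x ≠ 0) (hx : a * x ^ 2 + b * x + d ≠ 0) :
    HasSingularityAt (quartic ![a, 0, 1, b, 0, d] c) (affinePoint x 0) (.a n) := by
  have hDa : AnalyticAt ℂ (fun p : ℂ × ℂ => D.eval p.1) (x, 0) := by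
    have := AnalyticAt.aeval_polynomial (analyticAt_fst (𝕜 := ℂ) (p := ((x, 0) : ℂ × ℂ))) D
    simpa using this
  -- Separating powers of `y`, the equation is `(2 q(x, 0) + y²) y²` plus its restriction to the
  -- axis. The first coefficient is a unit off the conic, so the order of the restriction decides
  -- the type.
  refine hasSingularityAt_a (m := 3) (B := fun _ => 0) (D := fun p => D.eval p.1)
    (A := fun p => 2 * (a * p.1 ^ 2 + b * p.1 + d) + p.2 ^ 2) linearIndependent_affine_chart
    (affine_chart_mem_submodule (x, 0)) (isCoords_conicEval (k := ![0, 0, 0, 0, 1, 0])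
      (l := ![0, 0, 0, 1, 0, -x]) (by simp [conicEval]) (by simp [conicEval]) (by simp))
    (by fun_prop) analyticAt_const hDa (by simpa using hx) hDx (by norm_num) (by omega)
    (.of_forall fun p => ?_)
  rw [eval_affine_chart]
  have := hD p.1
  simp [conicEval, ← sub_eq_add_neg]
  linear_combination this

/-- The conic is `w = y² + x (b + a x)`, so `x = (w - y²) / (b + a x)`. Inserting this into `c² x³`
and expanding in the coordinates `w, y` leaves `-y⁶` times a unit as the lowest pure power of `y`.
-/
theorem hasSingularityAt_a5 {a b c : ℂ} (hc : c ≠ 0) (hb : b ≠ 0) :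
    HasSingularityAt (quartic ![a, 0, 1, b, 0, 0] c) (affinePoint 0 0) (.a 5) := by
  have hba : ∀ᶠ p : ℂ × ℂ in 𝓝 (0, 0), b + a * p.1 ≠ 0 := by
    have : ContinuousAt (fun p : ℂ × ℂ => b + a * p.1) (0, 0) := by fun_prop
    exact this.eventually_ne (by simpa using hb)
  have he : AnalyticAt ℂ (fun p : ℂ × ℂ => c ^ 2 / (b + a * p.1) ^ 3) (0, 0) := by
    refine AnalyticAt.div analyticAt_const ?_ (by simpa using hb)
    fun_prop
  have hw : AnalyticAt ℂ (fun p : ℂ × ℂ => conicEval ![a, 0, 1, b, 0, 0] p.1 p.2 1) (0, 0) := by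
    unfold conicEval
    fun_prop
  have hy : AnalyticAt ℂ (fun p : ℂ × ℂ => p.2) (0, 0) := by fun_prop
  refine hasSingularityAt_a (m := 4)
    (A := fun p => 1 + c ^ 2 / (b + a * p.1) ^ 3 *
      (conicEval ![a, 0, 1, b, 0, 0] p.1 p.2 1 - 3 * p.2 ^ 2))
    (B := fun p => 3 * (c ^ 2 / (b + a * p.1) ^ 3)) (D := fun p => -(c ^ 2 / (b + a * p.1) ^ 3))
    linearIndependent_affine_chart
    (affine_chart_mem_submodule (0, 0)) (isCoords_conicEval (k := ![a, 0, 1, b, 0, 0])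
      (l := ![0, 0, 0, 0, 1, 0]) (by simp [conicEval]) (by simp [conicEval]) (by simpa using hb))
    (analyticAt_const.add (he.mul (hw.sub (analyticAt_const.mul (hy.pow 2)))))
    (analyticAt_const.mul he) he.neg (by simp [conicEval]) (by simp [hc, hb]) (by norm_num)
    (by norm_num) ?_
  filter_upwards [hba] with p hp
  rw [eval_affine_chart]
  simp [conicEval]
  field_simp
  ring

/-- Expanding gives `(c² + a² x) x³ + 2 a x² y² + y⁴`. -/
theorem hasSingularityAt_e6_origin {a c : ℂ} (hc : c ≠ 0) :
    HasSingularityAt (quartic ![a, 0, 1, 0, 0, 0] c) (affinePoint 0 0) .e6 := by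
  refine hasSingularityAt_e6 (A := fun p => c ^ 2 + a ^ 2 * p.1) (B := fun _ => 2 * a)
    (D := fun _ => 1) linearIndependent_affine_chart (affine_chart_mem_submodule (0, 0))
    (isCoords_conicEval (k := ![0, 0, 0, 1, 0, 0]) (l := ![0, 0, 0, 0, 1, 0])
      (by simp [conicEval]) (by simp [conicEval]) (by simp))
    (by fun_prop) analyticAt_const analyticAt_const (by simpa using hc) one_ne_zero
    (.of_forall fun p => ?_)
  rw [eval_affine_chart]
  simp [conicEval]
  ring

/-- In the chart `Y = 1` the conic is `w = x + t z + z²`. Substituting `x = w - z (t + z)` into `x³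
z` gives the pure term `-(t + z)³ z⁴`, of order exactly 4 because `t ≠ 0`. -/
theorem hasSingularityAt_a3 {t : ℂ} (ht : t ≠ 0) :
    HasSingularityAt (quartic ![0, 1, 0, 0, t, 1] 1) verticalPoint (.a 3) := by
  refine hasSingularityAt_a (m := 3)
    (A := fun p => 1 + p.2 * (conicEval ![0, 0, 1, 1, t, 0] p.1 p.2 1 - 3 * p.2 * (t + p.2)))
    (B := fun p => 3 * (t + p.2) ^ 2) (D := fun p => -(t + p.2) ^ 3)
    linearIndependent_vertical_chart vertical_chart_mem_submodule
    (isCoords_conicEval (k := ![0, 0, 1, 1, t, 0]) (l := ![0, 0, 0, 0, 1, 0])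
      (by simp [conicEval]) (by simp [conicEval]) (by simp))
    (by unfold conicEval; fun_prop) (by fun_prop) (by fun_prop) (by simp) (by simpa using ht)
    (by norm_num) (by norm_num) (.of_forall fun p => ?_)
  rw [eval_vertical_chart]
  simp [conicEval]
  ring

/-- For `t = 0` the same substitution is `x = w - z²`, and the pure term in `z` becomes `-z⁷`. -/
theorem hasSingularityAt_a6 :
    HasSingularityAt (quartic ![0, 1, 0, 0, 0, 1] 1) verticalPoint (.a 6) := by
  refine hasSingularityAt_a (m := 5)
    (A := fun p => 1 + p.2 * (conicEval ![0, 0, 1, 1, 0, 0] p.1 p.2 1 - 3 * p.2 ^ 2))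
    (B := fun _ => 3) (D := fun _ => -1)
    linearIndependent_vertical_chart vertical_chart_mem_submodule
    (isCoords_conicEval (k := ![0, 0, 1, 1, 0, 0]) (l := ![0, 0, 0, 0, 1, 0])
      (by simp [conicEval]) (by simp [conicEval]) (by simp))
    (by unfold conicEval; fun_prop) (by fun_prop) (by fun_prop) (by simp) (by simp)
    (by norm_num) (by norm_num) (.of_forall fun p => ?_)
  rw [eval_vertical_chart]
  simp [conicEval]
  ring

/-- Here `w = x² + z`, and `x³ z = w x³ - x⁵`. -/
theorem hasSingularityAt_a4 :
    HasSingularityAt (quartic ![1, 0, 0, 0, 1, 0] 1) verticalPoint (.a 4) := by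
  refine hasSingularityAt_a (m := 3) (A := fun _ => 1) (B := fun _ => 1) (D := fun _ => -1)
    linearIndependent_vertical_chart vertical_chart_mem_submodule
    (isCoords_conicEval (k := ![1, 0, 0, 0, 1, 0]) (l := ![0, 0, 0, 1, 0, 0])
      (by simp [conicEval]) (by simp [conicEval]) (by simp))
    (by fun_prop) (by fun_prop) (by fun_prop) (by simp) (by simp)
    (by norm_num) (by norm_num) (.of_forall fun p => ?_)
  rw [eval_vertical_chart]
  simp [conicEval]
  ring

open SingularityType Place

/-! ### Sets of singular points -/

theorem hasSingularities_singleton {F : MvPolynomial (Fin 3) ℂ} {P : P2}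
    {τ : SingularityType × Place} (hs : singularLocus F = {P}) (h : HasSingularityAt F P τ.1)
    (hp : τ.2.Contains P) : HasSingularities F [τ] := by
  refine ⟨fun _ => P, fun i j _ => Subsingleton.elim (α := Fin 1) i j, ?_, fun i => ?_⟩
  · rw [hs]
    exact Set.range_const (ι := Fin 1)
  · obtain rfl : i = (0 : Fin 1) := Subsingleton.elim (α := Fin 1) i 0
    exact ⟨h, hp⟩

theorem hasSingularities_pair {F : MvPolynomial (Fin 3) ℂ} {P₁ P₂ : P2}
    {τ₁ τ₂ : SingularityType × Place} (hne : P₁ ≠ P₂) (hs : singularLocus F = {P₁, P₂})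
    (h₁ : HasSingularityAt F P₁ τ₁.1) (hp₁ : τ₁.2.Contains P₁)
    (h₂ : HasSingularityAt F P₂ τ₂.1) (hp₂ : τ₂.2.Contains P₂) :
    HasSingularities F [τ₁, τ₂] := by
  have hinj : Function.Injective (![P₁, P₂] : Fin 2 → P2) := by
    intro i j
    fin_cases i <;> fin_cases j <;> simp [hne, hne.symm]
  refine ⟨(![P₁, P₂] : Fin 2 → P2), hinj, ?_, Fin.forall_fin_two.2 ⟨⟨h₁, hp₁⟩, ⟨h₂, hp₂⟩⟩⟩
  rw [hs]
  exact Matrix.range_cons_cons_empty P₁ P₂ _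

theorem hasSingularities_triple {F : MvPolynomial (Fin 3) ℂ} {P₁ P₂ P₃ : P2}
    {τ₁ τ₂ τ₃ : SingularityType × Place} (h12 : P₁ ≠ P₂) (h13 : P₁ ≠ P₃) (h23 : P₂ ≠ P₃)
    (hs : singularLocus F = {P₁, P₂, P₃})
    (h₁ : HasSingularityAt F P₁ τ₁.1) (hp₁ : τ₁.2.Contains P₁)
    (h₂ : HasSingularityAt F P₂ τ₂.1) (hp₂ : τ₂.2.Contains P₂)
    (h₃ : HasSingularityAt F P₃ τ₃.1) (hp₃ : τ₃.2.Contains P₃) :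
    HasSingularities F [τ₁, τ₂, τ₃] := by
  have hinj : Function.Injective (![P₁, P₂, P₃] : Fin 3 → P2) := by
    intro i j
    fin_cases i <;> fin_cases j <;> simp [h12, h12.symm, h13, h13.symm, h23, h23.symm]
  refine ⟨(![P₁, P₂, P₃] : Fin 3 → P2), hinj, ?_, ?_⟩
  · rw [hs]
    change Set.range ![P₁, P₂, P₃] = _
    ext P
    simp only [Matrix.range_cons, Matrix.range_empty, Set.mem_union, Set.mem_insert_iff,
      Set.mem_singleton_iff, Set.mem_empty_iff_false, or_false]
  · intro i
    change Fin 3 at i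
    fin_cases i
    exacts [⟨h₁, hp₁⟩, ⟨h₂, hp₂⟩, ⟨h₃, hp₃⟩]

section

variable {k : Fin 6 → ℂ} {c : ℂ}

theorem mem_singularLocus_iff (hc : c ≠ 0) (P : P2) :
    P ∈ singularLocus (quartic k c) ↔ (P = verticalPoint ∧ k 2 = 0) ∨
      ∃ x y, P = affinePoint x y ∧
        ((x = 0 ∧ k 2 * y ^ 2 + k 4 * y + k 5 = 0) ∨ IsExtraSingular k c x y) := by
  rcases P2_cases P with ⟨x, y, rfl⟩ | ⟨t, rfl⟩ | rfl
  · rw [affinePoint_mem_singularLocus hc]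
    simp only [affinePoint_ne_verticalPoint, false_and, false_or, affinePoint_inj]
    constructor
    · intro h
      exact ⟨x, y, ⟨rfl, rfl⟩, h⟩
    · rintro ⟨x, y, ⟨rfl, rfl⟩, h⟩
      exact h
  · simp [infinitePoint_notMem_singularLocus hc, affinePoint_ne_infinitePoint.symm]
  · simp [verticalPoint_mem_singularLocus, affinePoint_ne_verticalPoint.symm]

/-- A nonzero discriminant makes the conic cross `X = 0` transversally at two affine points. -/
theorem exists_two_cusps (hc : c ≠ 0) (h2 : k 2 ≠ 0) (hD : k 4 ^ 2 - 4 * k 2 * k 5 ≠ 0) :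
    ∃ y₁ y₂, y₁ ≠ y₂ ∧ (∀ y, k 2 * y ^ 2 + k 4 * y + k 5 = 0 ↔ y = y₁ ∨ y = y₂) ∧
      HasSingularityAt (quartic k c) (affinePoint 0 y₁) (a 2) ∧
      HasSingularityAt (quartic k c) (affinePoint 0 y₂) (a 2) := by
  obtain ⟨r, hr⟩ := IsAlgClosed.exists_pow_nat_eq (k 4 ^ 2 - 4 * k 2 * k 5) two_pos
  have hr0 : r ≠ 0 := by
    rintro rfl
    exact hD (by rw [← hr]; ring)
  have hfac : ∀ y, k 2 * y ^ 2 + k 4 * y + k 5 =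
      k 2 * ((y - (-k 4 + r) / (2 * k 2)) * (y - (-k 4 - r) / (2 * k 2))) := by
    intro y
    field_simp
    linear_combination hr
  have hiff : ∀ y, k 2 * y ^ 2 + k 4 * y + k 5 = 0 ↔
      y = (-k 4 + r) / (2 * k 2) ∨ y = (-k 4 - r) / (2 * k 2) := by
    intro y
    rw [hfac]
    simp [h2, sub_eq_zero]
  refine ⟨_, _, ?_, hiff, hasSingularityAt_cusp hc ((hiff _).2 (.inl rfl)) ?_,
    hasSingularityAt_cusp hc ((hiff _).2 (.inr rfl)) ?_⟩
  · intro h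
    field_simp at h
    exact hr0 (by linear_combination h / 2)
  · intro h
    field_simp at h
    exact hr0 (by linear_combination h)
  · intro h
    field_simp at h
    exact hr0 (by linear_combination -h)

theorem hasSingularities_two_cusps (hc : c ≠ 0) (h2 : k 2 ≠ 0)
    (hD : k 4 ^ 2 - 4 * k 2 * k 5 ≠ 0) (hE : ∀ x y, ¬IsExtraSingular k c x y) :
    HasSingularities (quartic k c) [(a 2, affine), (a 2, affine)] := by
  obtain ⟨y₁, y₂, hne, hy, hs₁, hs₂⟩ := exists_two_cusps hc h2 hD
  refine hasSingularities_pair (P₁ := affinePoint 0 y₁) (P₂ := affinePoint 0 y₂) (by simpa using hne)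
    ?_ hs₁ affinePoint_notMem_lineAtInfinity hs₂ affinePoint_notMem_lineAtInfinity
  ext P
  simp only [mem_singularLocus_iff hc, hE, hy, h2, Set.mem_insert_iff, Set.mem_singleton_iff]
  aesop

theorem hasSingularities_two_cusps_add (hc : c ≠ 0) (h2 : k 2 ≠ 0)
    (hD : k 4 ^ 2 - 4 * k 2 * k 5 ≠ 0) {x₀ y₀ : ℂ} (hx₀ : x₀ ≠ 0)
    (hE : ∀ x y, IsExtraSingular k c x y ↔ x = x₀ ∧ y = y₀) {τ : SingularityType}
    (hτ : HasSingularityAt (quartic k c) (affinePoint x₀ y₀) τ) :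
    HasSingularities (quartic k c) [(a 2, affine), (a 2, affine), (τ, affine)] := by
  obtain ⟨y₁, y₂, hne, hy, hs₁, hs₂⟩ := exists_two_cusps hc h2 hD
  refine hasSingularities_triple (P₁ := affinePoint 0 y₁) (P₂ := affinePoint 0 y₂)
    (P₃ := affinePoint x₀ y₀) (by simpa using hne) (by simp [hx₀.symm]) (by simp [hx₀.symm])
    ?_ hs₁ affinePoint_notMem_lineAtInfinity hs₂ affinePoint_notMem_lineAtInfinity
    hτ affinePoint_notMem_lineAtInfinity
  ext P
  simp only [mem_singularLocus_iff hc, hE, hy, h2, Set.mem_insert_iff, Set.mem_singleton_iff]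
  aesop

end

/-! ### Conics symmetric in `y` -/

section

variable {a b d c : ℂ}

/-- The `y`-derivative forces `y = 0`. The other two conditions say that `τ` is a nonzero multiple
root of `p(τ) = a τ⁴ - c τ³ - b τ² + d`, the second one being `p'(τ) / τ = 0`. -/
theorem isExtraSingular_axis {x y : ℂ} : IsExtraSingular ![a, 0, 1, b, 0, d] c x y ↔
    y = 0 ∧ ∃ τ : ℂ, τ ≠ 0 ∧ x = -τ ^ 2 ∧ a * τ ^ 4 - b * τ ^ 2 + d = c * τ ^ 3 ∧
      4 * a * τ ^ 2 - 3 * c * τ - 2 * b = 0 := by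
  constructor
  · rintro ⟨τ, hτ, rfl, h1, h2, h3⟩
    have hy : y = 0 := by simpa using h3
    subst hy
    simp [conicEval] at h1 h2
    exact ⟨rfl, τ, hτ, rfl, by linear_combination h1, by linear_combination -h2⟩
  · rintro ⟨rfl, τ, hτ, rfl, h1, h2⟩
    refine ⟨τ, hτ, rfl, ?_, ?_, by simp⟩
    · simp [conicEval]
      linear_combination h1
    · simp
      linear_combination -h2

theorem position_i_axis (hc : c ≠ 0) (ha : a ≠ 0) :
    Position.i.Holds (quartic ![a, 0, 1, b, 0, d] c) := by
  obtain ⟨r, hr⟩ := IsAlgClosed.exists_pow_nat_eq (-a) two_pos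
  have hr0 : r ≠ 0 := by
    rintro rfl
    exact ha (by simpa using hr)
  refine position_i hc (t₁ := r) (t₂ := -r) (by simp) ?_ ?_ (by simp)
  · intro h
    exact hr0 (by linear_combination h / 2)
  · simp
    linear_combination hr

theorem position_iv_axis (hc : c ≠ 0) : Position.iv.Holds (quartic ![0, 0, 1, b, 0, d] c) :=
  position_iv hc (t := 0) (by simp) (by simp) (by simp)

theorem hasSingularities_axis_origin (hc : c ≠ 0)
    (hE : ∀ τ : ℂ, τ ≠ 0 → a * τ ^ 4 - b * τ ^ 2 = c * τ ^ 3 →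
      4 * a * τ ^ 2 - 3 * c * τ - 2 * b ≠ 0) {τ : SingularityType}
    (hτ : HasSingularityAt (quartic ![a, 0, 1, b, 0, 0] c) (affinePoint 0 0) τ) :
    HasSingularities (quartic ![a, 0, 1, b, 0, 0] c) [(τ, affine)] := by
  refine hasSingularities_singleton (P := affinePoint 0 0) ?_ hτ affinePoint_notMem_lineAtInfinity
  have hE' : ∀ x y, ¬IsExtraSingular ![a, 0, 1, b, 0, 0] c x y := by
    intro x y h
    obtain ⟨-, τ, hτ, -, h1, h2⟩ := isExtraSingular_axis.1 h
    exact hE τ hτ (by linear_combination h1) h2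
  ext P
  simp only [mem_singularLocus_iff hc, hE', Set.mem_singleton_iff]
  simp

end

/-! ### Analytic families -/

theorem analyticOnNhd_coeff_quartic {E : Type} [NormedAddCommGroup E] [NormedSpace ℂ E]
    {U : Set E} {k : E → Fin 6 → ℂ} {c : E → ℂ} (hk : ∀ i, AnalyticOnNhd ℂ (fun p => k p i) U)
    (hc : AnalyticOnNhd ℂ c U) (m : Fin 3 →₀ ℕ) :
    AnalyticOnNhd ℂ (fun p => (quartic (k p) (c p)).coeff m) U := by
  have hq : ∀ m, AnalyticOnNhd ℂ (fun p => (conic (k p)).coeff m) U := by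
    intro m
    simp only [conic, MvPolynomial.coeff_add, MvPolynomial.coeff_C_mul]
    exact ((((((hk 0).mul analyticOnNhd_const).add ((hk 1).mul analyticOnNhd_const)).add
      ((hk 2).mul analyticOnNhd_const)).add ((hk 3).mul analyticOnNhd_const)).add
      ((hk 4).mul analyticOnNhd_const)).add ((hk 5).mul analyticOnNhd_const)
  simp only [quartic, MvPolynomial.coeff_add, MvPolynomial.coeff_C_mul, sq (conic _),
    MvPolynomial.coeff_mul (conic _)]
  exact (Finset.analyticOnNhd_fun_sum _ fun x _ => (hq x.1).mul (hq x.2)).add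
    ((hc.pow 2).mul analyticOnNhd_const)

/-- At the three coordinate vertices `X³ Z` vanishes and the quartic takes the values `k 0 ^ 2`, `k
2 ^ 2`, `k 5 ^ 2`. -/
theorem quartic_ne_zero {k : Fin 6 → ℂ} {c : ℂ} (h : k 0 ≠ 0 ∨ k 2 ≠ 0 ∨ k 5 ≠ 0) :
    quartic k c ≠ 0 := by
  intro h0
  have he := fun v => eval_quartic k c v
  rw [h0] at he
  have h1 := he ![1, 0, 0]
  have h2 := he ![0, 1, 0]
  have h3 := he ![0, 0, 1]
  simp [conicEval] at h1 h2 h3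
  simp [pow_eq_zero_iff two_ne_zero |>.1 h1.symm, pow_eq_zero_iff two_ne_zero |>.1 h2.symm,
    pow_eq_zero_iff two_ne_zero |>.1 h3.symm] at h

theorem isAnalyticFamily_quartic {E : Type} [NormedAddCommGroup E] [NormedSpace ℂ E]
    {U : Set E} {k : E → Fin 6 → ℂ} {c : E → ℂ} (hk : ∀ i, AnalyticOnNhd ℂ (fun p => k p i) U)
    (hc : AnalyticOnNhd ℂ c U) (h0 : ∀ p ∈ U, k p 0 ≠ 0 ∨ k p 2 ≠ 0 ∨ k p 5 ≠ 0) :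
    IsAnalyticFamily U fun p => quartic (k p) (c p) :=
  ⟨fun _ hp => ⟨isHomogeneous_quartic _ _, quartic_ne_zero (h0 _ hp)⟩,
    analyticOnNhd_coeff_quartic hk hc⟩

/-- A degeneration along a curve in the base of an analytic family. -/
theorem DegeneratesTo.of_family {E : Type} [NormedAddCommGroup E] [NormedSpace ℂ E]
    {F : E → MvPolynomial (Fin 3) ℂ} (hF : IsAnalyticFamily Set.univ F) {n m : ℕ} (γ : ℂ → E)
    (hγ : AnalyticOnNhd ℂ γ Set.univ) {g : ℂ → ℂ} (hg : Continuous g) (hg0 : g 0 ≠ 0)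
    (hn : ∀ s, g s ≠ 0 → s ≠ 0 → F (γ s) ∈ QL n) (hm : F (γ 0) ∈ QL m) : DegeneratesTo n m :=
  ⟨{s | g s ≠ 0}, F ∘ γ, isOpen_ne_fun hg continuous_const, hg0,
    ⟨fun _ _ => hF.1 _ trivial,
      fun i _ _ => (hF.2 i _ trivial).comp (hγ _ trivial)⟩, hn, hm⟩

theorem exists_ne_zero_apply_ne_zero {g : ℂ → ℂ} (hg : Continuous g) (h0 : g 0 ≠ 0) :
    ∃ s ≠ 0, g s ≠ 0 := by
  have h1 : ∀ᶠ s in 𝓝[≠] (0 : ℂ), g s ≠ 0 :=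
    (hg.continuousAt.eventually_ne h0).filter_mono nhdsWithin_le_nhds
  obtain ⟨s, hs, hs'⟩ := (h1.and self_mem_nhdsWithin).exists
  exact ⟨s, hs', hs⟩

theorem analyticOnNhd_proj {n : ℕ} (i : Fin n) :
    AnalyticOnNhd ℂ (fun p : Fin n → ℂ => p i) Set.univ :=
  (ContinuousLinearMap.proj (R := ℂ) (φ := fun _ : Fin n => ℂ) i).analyticOnNhd _

/-! ### A family around `QL 12` -/

/-- The exceptional equation of the family around `QL 12`. -/
noncomputable def exceptionalE6 : MvPolynomial (Fin 3) ℂ :=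
  let s := MvPolynomial.X 0
  let w := MvPolynomial.X 1 * MvPolynomial.X 2
  let N := 64 * w ^ 2 * s - 16 * w - 6
  let M := 32 * w + 9
  N ^ 3 + 2 * N ^ 2 * M - 4 * s * M ^ 3

theorem eval_exceptionalE6 (s t u : ℂ) : exceptionalE6.eval ![s, t, u] =
    (64 * (t * u) ^ 2 * s - 16 * (t * u) - 6) ^ 3 +
      2 * (64 * (t * u) ^ 2 * s - 16 * (t * u) - 6) ^ 2 * (32 * (t * u) + 9) -
      4 * s * (32 * (t * u) + 9) ^ 3 := by
  simp [exceptionalE6]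

/-- For `u ≠ 0`, putting `τ = u σ` turns the two conditions into equations in `σ` that involve only
`s` and `w = t u`. This is why the constant term of the conic is `s u³`: after elimination `H` stays
nonzero on the `t`- and `u`-axes. -/
theorem no_extra_E6 {s t u τ : ℂ} (hτ : τ ≠ 0)
    (hH : u = 0 ∨ exceptionalE6.eval ![s, t, u] ≠ 0)
    (h : t * τ ^ 4 - u * τ ^ 2 + s * u ^ 3 = 1 * τ ^ 3) :
    4 * t * τ ^ 2 - 3 * 1 * τ - 2 * u ≠ 0 := by
  intro h'
  by_cases hu : u = 0
  · subst hu
    refine pow_ne_zero 3 hτ ?_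
    linear_combination τ ^ 2 * h' - 4 * h
  · have hH := hH.resolve_left hu
    rw [eval_exceptionalE6] at hH
    obtain ⟨σ, rfl⟩ : ∃ σ, τ = u * σ := ⟨τ / u, by field_simp⟩
    have hq : 4 * (t * u) * σ ^ 2 - 3 * σ - 2 = 0 := by
      refine (mul_eq_zero.1 (?_ : u * _ = 0)).resolve_left hu
      linear_combination h'
    have hr : σ ^ 3 + 2 * σ ^ 2 - 4 * s = 0 := by
      refine (mul_eq_zero.1 (?_ : u ^ 3 * _ = 0)).resolve_left (pow_ne_zero 3 hu)
      linear_combination u ^ 2 * σ ^ 2 * h' - 4 * h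
    generalize t * u = w at *
    -- A Euclidean step reduces the quadratic and the cubic to a linear relation `M σ = N`.
    -- Multiplying the cubic by `M³`, rather than dividing by `M`, also covers `M = 0`.
    have hσ : (32 * w + 9) * σ = 64 * w ^ 2 * s - 16 * w - 6 := by
      linear_combination -(8 * w + 3) * hq + 4 * w * (4 * w * hr - σ * hq)
    apply hH
    rw [← hσ]
    linear_combination (32 * w + 9) ^ 3 * hr

/-- The conic is `y² + t x² + u x + s u³`: at `s = 0` it touches `X = 0` at the origin, at `s = u =
0` it becomes singular there, and at `t = 0` its two points at infinity coincide. -/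
theorem exists_family_E6 :
    ∃ (F : (Fin 3 → ℂ) → MvPolynomial (Fin 3) ℂ) (H : MvPolynomial (Fin 3) ℂ),
      IsAnalyticFamily Set.univ F ∧
      (∀ t : ℂ, H.eval ![0, t, 0] ≠ 0) ∧ (∀ u : ℂ, H.eval ![0, 0, u] ≠ 0) ∧
      (∀ s t u : ℂ, H.eval ![s, t, u] ≠ 0 → s * t * u ≠ 0 → F ![s, t, u] ∈ QL 1) ∧
      (∀ t u : ℂ, H.eval ![0, t, u] ≠ 0 → t * u ≠ 0 → F ![0, t, u] ∈ QL 7) ∧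
      (∀ t : ℂ, t ≠ 0 → F ![0, t, 0] ∈ QL 11) ∧
      (∀ s u : ℂ, H.eval ![s, 0, u] ≠ 0 → s * u ≠ 0 → F ![s, 0, u] ∈ QL 2) ∧
      (∀ u : ℂ, u ≠ 0 → F ![0, 0, u] ∈ QL 8) ∧
      F ![0, 0, 0] ∈ QL 12 := by
  have hHt : ∀ t : ℂ, exceptionalE6.eval ![0, t, 0] ≠ 0 := by
    intro t
    norm_num [eval_exceptionalE6]
  have hHu : ∀ u : ℂ, exceptionalE6.eval ![0, 0, u] ≠ 0 := by
    intro u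
    norm_num [eval_exceptionalE6]
  have hcusps : ∀ s t u : ℂ, exceptionalE6.eval ![s, t, u] ≠ 0 → s * u ≠ 0 →
      HasSingularities (quartic ![t, 0, 1, u, 0, s * u ^ 3] 1) [(a 2, affine), (a 2, affine)] := by
    intro s t u hH hsu
    refine hasSingularities_two_cusps one_ne_zero (by simp) ?_ ?_
    · have hs := left_ne_zero_of_mul hsu
      have hu := right_ne_zero_of_mul hsu
      simp [hs, hu]
    · intro x y h
      obtain ⟨-, τ, hτ, -, h1, h2⟩ := isExtraSingular_axis.1 h
      exact no_extra_E6 hτ (.inr hH) h1 h2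
  have hE : ∀ t u : ℂ, (u = 0 ∨ exceptionalE6.eval ![0, t, u] ≠ 0) → ∀ τ : ℂ, τ ≠ 0 →
      t * τ ^ 4 - u * τ ^ 2 = 1 * τ ^ 3 → 4 * t * τ ^ 2 - 3 * 1 * τ - 2 * u ≠ 0 :=
    fun t u hH τ hτ h => no_extra_E6 hτ hH (s := 0) (by linear_combination h)
  refine ⟨fun p => quartic ![p 1, 0, 1, p 2, 0, p 0 * p 2 ^ 3] 1, exceptionalE6,
    isAnalyticFamily_quartic ?_ analyticOnNhd_const (by simp), hHt, hHu, ?_, ?_, ?_, ?_, ?_, ?_⟩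
  · intro i
    fin_cases i
    exacts [analyticOnNhd_proj 1, analyticOnNhd_const, analyticOnNhd_const, analyticOnNhd_proj 2,
      analyticOnNhd_const, (analyticOnNhd_proj 0).mul ((analyticOnNhd_proj 2).pow 3)]
  · intro s t u hH h
    have hs : s ≠ 0 := left_ne_zero_of_mul (left_ne_zero_of_mul h)
    have ht : t ≠ 0 := right_ne_zero_of_mul (left_ne_zero_of_mul h)
    have hu : u ≠ 0 := right_ne_zero_of_mul h
    exact ⟨isHomogeneous_quartic _ _, hcusps s t u hH (mul_ne_zero hs hu),
      position_i_axis one_ne_zero ht⟩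
  · intro t u hH h
    have ht := left_ne_zero_of_mul h
    have hu := right_ne_zero_of_mul h
    simp only [Matrix.cons_val, zero_mul]
    exact ⟨isHomogeneous_quartic _ _, hasSingularities_axis_origin one_ne_zero (hE t u (.inr hH))
      (hasSingularityAt_a5 one_ne_zero hu), position_i_axis one_ne_zero ht⟩
  · intro t ht
    simp only [Matrix.cons_val, zero_mul]
    exact ⟨isHomogeneous_quartic _ _, hasSingularities_axis_origin one_ne_zero (hE t 0 (.inl rfl))
      (hasSingularityAt_e6_origin one_ne_zero), position_i_axis one_ne_zero ht⟩
  · intro s u hH h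
    exact ⟨isHomogeneous_quartic _ _, hcusps s 0 u hH h, position_iv_axis one_ne_zero⟩
  · intro u hu
    simp only [Matrix.cons_val, zero_mul]
    exact ⟨isHomogeneous_quartic _ _, hasSingularities_axis_origin one_ne_zero
      (hE 0 u (.inr (hHu u))) (hasSingularityAt_a5 one_ne_zero hu), position_iv_axis one_ne_zero⟩
  · simp only [Matrix.cons_val, zero_mul]
    exact ⟨isHomogeneous_quartic _ _, hasSingularities_axis_origin one_ne_zero
      (hE 0 0 (.inl rfl)) (hasSingularityAt_e6_origin one_ne_zero), position_iv_axis one_ne_zero⟩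

/-! ### A family around `QL 5` and `QL 4` -/

/-- The exceptional equation of the family around `QL 5` and `QL 4`. -/
noncomputable def exceptionalNode : MvPolynomial (Fin 3) ℂ :=
  let s := MvPolynomial.X 0
  let t := MvPolynomial.X 1
  let u := MvPolynomial.X 2
  (256 * s * t ^ 3 - 9 * (8 * t + 3 * u)) * (8 * t + 3 * u) * (6 * s * u ^ 3 - 2 * t - 3 * u)

theorem eval_exceptionalNode (s t u : ℂ) : exceptionalNode.eval ![s, t, u] =
    (256 * s * t ^ 3 - 9 * (8 * t + 3 * u)) * (8 * t + 3 * u) *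
      (6 * s * u ^ 3 - 2 * t - 3 * u) := by
  simp [exceptionalNode]

/-- The derivative condition factors as `(τ - 1)(4 t τ - 4 t - 3 u) = 0`. At the second root the
value of `p` is excluded by the first factor of `H`. -/
theorem eq_one_of_extra_node {s t u τ : ℂ}
    (hH : u = 0 ∧ t ≠ 0 ∨ exceptionalNode.eval ![s, t, u] ≠ 0)
    (h : t * τ ^ 4 - (-2 * t - 3 / 2 * u) * τ ^ 2 + (-t / 3 - u / 2 + s * u ^ 3) =
      (8 / 3 * t + u) * τ ^ 3)
    (h' : 4 * t * τ ^ 2 - 3 * (8 / 3 * t + u) * τ - 2 * (-2 * t - 3 / 2 * u) = 0) : τ = 1 := by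
  by_contra hτ
  have h1 : 4 * t * τ = 4 * t + 3 * u := by
    refine sub_eq_zero.1 ((mul_eq_zero.1 (?_ : (τ - 1) * _ = 0)).resolve_left (sub_ne_zero.2 hτ))
    linear_combination h'
  by_cases hu : u = 0
  · subst hu
    by_cases ht : t = 0
    · subst ht
      simp [eval_exceptionalNode] at hH
    · exact hτ (mul_left_cancel₀ ht (by linear_combination h1 / 4))
  · have hH := hH.resolve_left fun h => hu h.1
    rw [eval_exceptionalNode] at hH
    refine left_ne_zero_of_mul (left_ne_zero_of_mul hH) ?_
    refine (mul_eq_zero.1 (?_ : u ^ 3 * _ = 0)).resolve_left (pow_ne_zero 3 hu)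
    have ht : t ≠ 0 := by
      rintro rfl
      exact hu (by linear_combination -h1 / 3)
    obtain rfl : τ = (4 * t + 3 * u) / (4 * t) := by
      field_simp
      linear_combination h1
    field_simp at h
    linear_combination h / 6

/-- The coefficients are chosen so that `p` has a critical point at `τ = 1` with `p(1) = s u³`. At
`s = 0` this becomes a double root, giving a node at `(-1, 0)`; at `u = 0` both critical points
merge, the root is triple and the node becomes a cusp. The other factors of `H` are `3 c` and `6 d`,
for the constant term `d` of the conic. -/
theorem exists_family_node :
    ∃ (F : (Fin 3 → ℂ) → MvPolynomial (Fin 3) ℂ) (H : MvPolynomial (Fin 3) ℂ),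
      IsAnalyticFamily Set.univ F ∧
      (∀ t : ℂ, t ≠ 0 → H.eval ![0, t, 0] ≠ 0) ∧ (∀ u : ℂ, u ≠ 0 → H.eval ![0, 0, u] ≠ 0) ∧
      (∀ s t u : ℂ, H.eval ![s, t, u] ≠ 0 → s * t * u ≠ 0 → F ![s, t, u] ∈ QL 1) ∧
      (∀ t u : ℂ, H.eval ![0, t, u] ≠ 0 → t * u ≠ 0 → F ![0, t, u] ∈ QL 3) ∧
      (∀ t : ℂ, t ≠ 0 → F ![0, t, 0] ∈ QL 5) ∧
      (∀ s u : ℂ, H.eval ![s, 0, u] ≠ 0 → s * u ≠ 0 → F ![s, 0, u] ∈ QL 2) ∧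
      (∀ u : ℂ, u ≠ 0 → F ![0, 0, u] ∈ QL 4) := by
  have hHt : ∀ t : ℂ, t ≠ 0 → exceptionalNode.eval ![0, t, 0] ≠ 0 := by
    intro t ht
    simp [eval_exceptionalNode, ht]
  have hHu : ∀ u : ℂ, u ≠ 0 → exceptionalNode.eval ![0, 0, u] ≠ 0 := by
    intro u hu
    simp [eval_exceptionalNode, hu]
  have hc : ∀ s t u : ℂ, exceptionalNode.eval ![s, t, u] ≠ 0 → 8 / 3 * t + u ≠ 0 := by
    intro s t u hH h
    rw [eval_exceptionalNode] at hH
    exact right_ne_zero_of_mul (left_ne_zero_of_mul hH) (by linear_combination 3 * h)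
  have hd : ∀ s t u : ℂ, exceptionalNode.eval ![s, t, u] ≠ 0 → -t / 3 - u / 2 + s * u ^ 3 ≠ 0 := by
    intro s t u hH h
    rw [eval_exceptionalNode] at hH
    exact right_ne_zero_of_mul hH (by linear_combination 6 * h)
  set F : (Fin 3 → ℂ) → MvPolynomial (Fin 3) ℂ := fun p => quartic
    ![p 1, 0, 1, -2 * p 1 - 3 / 2 * p 2, 0, -p 1 / 3 - p 2 / 2 + p 0 * p 2 ^ 3]
    (8 / 3 * p 1 + p 2) with hF
  have hcusps : ∀ s t u : ℂ, exceptionalNode.eval ![s, t, u] ≠ 0 → s * u ≠ 0 →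
      HasSingularities (F ![s, t, u]) [(a 2, affine), (a 2, affine)] := by
    intro s t u hH hsu
    have hs := left_ne_zero_of_mul hsu
    have hu := right_ne_zero_of_mul hsu
    refine hasSingularities_two_cusps (hc s t u hH) (by simp) ?_ ?_
    · simpa using hd s t u hH
    · intro x y h
      obtain ⟨-, τ, hτ, -, h1, h2⟩ := isExtraSingular_axis.1 h
      obtain rfl := eq_one_of_extra_node (.inr hH) h1 h2
      refine mul_ne_zero hs (pow_ne_zero 3 hu) ?_
      simp only [Matrix.cons_val] at h1
      linear_combination h1
  have hextra : ∀ t u : ℂ, exceptionalNode.eval ![0, t, u] ≠ 0 → ∀ n : ℕ,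
      HasSingularityAt (F ![0, t, u]) (affinePoint (-1) 0) (.a n) →
      HasSingularities (F ![0, t, u]) [(a 2, affine), (a 2, affine), (a n, affine)] := by
    intro t u hH n hn
    refine hasSingularities_two_cusps_add (hc 0 t u hH) (by simp) ?_ (x₀ := -1) (y₀ := 0) (by simp)
      (fun x y => ?_) hn
    · simpa using hd 0 t u hH
    · refine isExtraSingular_axis.trans ⟨?_, ?_⟩
      · rintro ⟨hy, τ, hτ, hx, h1, h2⟩
        obtain rfl := eq_one_of_extra_node (.inr hH) h1 h2
        exact ⟨by simpa using hx, hy⟩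
      · rintro ⟨rfl, rfl⟩
        refine ⟨rfl, 1, one_ne_zero, by simp, ?_, ?_⟩ <;> simp <;> ring
  have hnode : ∀ t u : ℂ, exceptionalNode.eval ![0, t, u] ≠ 0 → u ≠ 0 →
      HasSingularityAt (F ![0, t, u]) (affinePoint (-1) 0) (.a 1) := by
    intro t u hH hu
    have hc' := hc 0 t u hH
    -- The quotient of the restriction to the axis by `(z + 1)²`; its value at `-1` is `-(3/4) u c`.
    refine hasSingularityAt_axis (D := .C (t ^ 2) * .X ^ 2 +
      .C ((8 / 3 * t + u) ^ 2 + 2 * t * (-2 * t - 3 / 2 * u) - 2 * t ^ 2) * .X +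
      .C ((-t / 3 - u / 2) ^ 2)) (by norm_num) ?_ ?_ ?_
    · intro z
      simp
      ring
    · intro h
      refine mul_ne_zero hu hc' ?_
      simp at h
      linear_combination -4 / 3 * h
    · intro h
      apply hc'
      simp at h
      linear_combination h
  have htriple : ∀ t : ℂ, t ≠ 0 →
      HasSingularityAt (F ![0, t, 0]) (affinePoint (-1) 0) (.a 2) := by
    intro t ht
    refine hasSingularityAt_axis (D := .C (t ^ 2) * .X + .C (t ^ 2 / 9)) le_rfl ?_ ?_ ?_
    · intro z
      simp
      ring
    · intro h
      refine pow_ne_zero 2 ht ?_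
      simp at h
      linear_combination -9 / 8 * h
    · intro h
      apply ht
      simp at h
      linear_combination 3 / 8 * h
  refine ⟨F, exceptionalNode, isAnalyticFamily_quartic ?_ ?_ (by simp), hHt, hHu, ?_, ?_, ?_, ?_, ?_⟩
  · have h0 := analyticOnNhd_proj (0 : Fin 3)
    have h1 := analyticOnNhd_proj (1 : Fin 3)
    have h2 := analyticOnNhd_proj (2 : Fin 3)
    intro i
    fin_cases i
    exacts [h1, analyticOnNhd_const, analyticOnNhd_const,
      (analyticOnNhd_const.mul h1).sub (analyticOnNhd_const.mul h2), analyticOnNhd_const,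
      ((h1.neg.div analyticOnNhd_const (by simp)).sub (h2.div analyticOnNhd_const (by simp))).add
        (h0.mul (h2.pow 3))]
  · exact (analyticOnNhd_const.mul (analyticOnNhd_proj 1)).add (analyticOnNhd_proj 2)
  · intro s t u hH h
    have hs : s ≠ 0 := left_ne_zero_of_mul (left_ne_zero_of_mul h)
    have ht : t ≠ 0 := right_ne_zero_of_mul (left_ne_zero_of_mul h)
    have hu : u ≠ 0 := right_ne_zero_of_mul h
    exact ⟨isHomogeneous_quartic _ _, hcusps s t u hH (mul_ne_zero hs hu),
      position_i_axis (hc s t u hH) ht⟩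
  · intro t u hH h
    have hu := right_ne_zero_of_mul h
    exact ⟨isHomogeneous_quartic _ _, hextra t u hH 1 (hnode t u hH hu),
      position_i_axis (hc 0 t u hH) (left_ne_zero_of_mul h)⟩
  · intro t ht
    exact ⟨isHomogeneous_quartic _ _, hextra t 0 (hHt t ht) 2 (htriple t ht),
      position_i_axis (hc 0 t 0 (hHt t ht)) ht⟩
  · intro s u hH h
    exact ⟨isHomogeneous_quartic _ _, hcusps s 0 u hH h, position_iv_axis (hc s 0 u hH)⟩
  · intro u hu
    exact ⟨isHomogeneous_quartic _ _, hextra 0 u (hHu u hu) 1 (hnode 0 u (hHu u hu) hu),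
      position_iv_axis (hc 0 0 u (hHu u hu))⟩

/-! ### A family around `QL 9` -/

/-- The exceptional equation of the family around `QL 9`. -/
noncomputable def exceptionalVertical : MvPolynomial (Fin 2) ℂ :=
  let s := MvPolynomial.X 0
  let t := MvPolynomial.X 1
  let m := 3 * s * t ^ 2
  (1 - 4 * s) * ((4 + m * t) ^ 2 + m * (4 + m * t) * (4 * t + m ^ 2) - t * (4 * t + m ^ 2) ^ 2)

theorem eval_exceptionalVertical (s t : ℂ) : exceptionalVertical.eval ![s, t] =
    (1 - 4 * s) * ((4 + 3 * s * t ^ 2 * t) ^ 2 +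
      3 * s * t ^ 2 * (4 + 3 * s * t ^ 2 * t) * (4 * t + (3 * s * t ^ 2) ^ 2) -
        t * (4 * t + (3 * s * t ^ 2) ^ 2) ^ 2) := by
  simp [exceptionalVertical]

/-- The derivative in `x` gives `y = -3τ/2`. The remaining conditions are a quadratic and a cubic in
`τ`, which combine to a linear one; substituting that in the quadratic yields the second factor of
`H`. -/
theorem no_extra_vertical {s t x y : ℂ} (hH : exceptionalVertical.eval ![s, t] ≠ 0) :
    ¬IsExtraSingular ![0, 1, s * t ^ 2, 0, t, 1] 1 x y := by
  rintro ⟨τ, -, rfl, h1, h2, h3⟩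
  rw [eval_exceptionalVertical] at hH
  simp [conicEval] at h1 h2 h3
  obtain rfl : y = -3 / 2 * τ := by linear_combination h2 / 2
  have he : τ ^ 2 + 3 * s * t ^ 2 * τ - t = 0 := by linear_combination -h3
  have hr : τ ^ 3 + 3 * t * τ - 4 = 0 := by linear_combination -4 * h1 - 3 * τ * h3
  refine right_ne_zero_of_mul hH ?_
  generalize 3 * s * t ^ 2 = m at *
  have hτ : (4 * t + m ^ 2) * τ = 4 + m * t := by linear_combination hr - (τ - m) * he
  rw [← hτ]
  linear_combination (4 * t + m ^ 2) ^ 2 * he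

/-- The conic is `XY + s t² Y² + t YZ + Z²`. At `s = 0` it passes through `[0 : 1 : 0]`, so one cusp
moves to infinity as `a₃`; at `s = t = 0` it is tangent to `X = 0` there and has no further point on
that line. With the factor `t²` the discriminant on `X = 0` is `t² (1 - 4 s)`, so `H` does not have
to vanish at `t = 0`. -/
theorem exists_family_vertical :
    ∃ (F : (Fin 2 → ℂ) → MvPolynomial (Fin 3) ℂ) (H : MvPolynomial (Fin 2) ℂ),
      IsAnalyticFamily Set.univ F ∧ H.eval ![0, 0] ≠ 0 ∧
      (∀ s t : ℂ, H.eval ![s, t] ≠ 0 → s * t ≠ 0 → F ![s, t] ∈ QL 1) ∧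
      (∀ t : ℂ, H.eval ![0, t] ≠ 0 → t ≠ 0 → F ![0, t] ∈ QL 6) ∧
      F ![0, 0] ∈ QL 9 := by
  have h00 : exceptionalVertical.eval ![0, 0] ≠ 0 := by
    norm_num [eval_exceptionalVertical]
  refine ⟨fun p => quartic ![0, 1, p 0 * p 1 ^ 2, 0, p 1, 1] 1, exceptionalVertical,
    isAnalyticFamily_quartic ?_ analyticOnNhd_const (by simp), h00, ?_, ?_, ?_⟩
  · intro i
    fin_cases i
    exacts [analyticOnNhd_const, analyticOnNhd_const,
      (analyticOnNhd_proj 0).mul ((analyticOnNhd_proj 1).pow 2), analyticOnNhd_const,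
      analyticOnNhd_proj 1, analyticOnNhd_const]
  · intro s t hH h
    have hs := left_ne_zero_of_mul h
    have ht := right_ne_zero_of_mul h
    refine ⟨isHomogeneous_quartic _ _, hasSingularities_two_cusps one_ne_zero (by simp [hs, ht]) ?_
      fun x y => no_extra_vertical hH, position_i one_ne_zero (t₁ := 0)
        (t₂ := -1 / (s * t ^ 2)) (by simp [hs, ht])
        (div_ne_zero (by simp) (mul_ne_zero hs (pow_ne_zero 2 ht))).symm (by simp) ?_⟩
    · intro h0
      rw [eval_exceptionalVertical] at hH
      refine mul_ne_zero (pow_ne_zero 2 ht) (left_ne_zero_of_mul hH) ?_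
      simp at h0
      linear_combination h0
    · simp
      field_simp
  · intro t hH ht
    simp only [Matrix.cons_val, zero_mul]
    refine ⟨isHomogeneous_quartic _ _, hasSingularities_pair (P₁ := affinePoint 0 (-1 / t))
      (P₂ := verticalPoint) (by simp) ?_ (hasSingularityAt_cusp one_ne_zero ?_ ?_)
      affinePoint_notMem_lineAtInfinity (hasSingularityAt_a3 ht) verticalPoint_mem_lineAtInfinity,
      position_ii one_ne_zero (t := 0) (by simp) (by simp) (by simp)⟩
    · have hE : ∀ x y, ¬IsExtraSingular ![0, 1, 0, 0, t, 1] 1 x y := by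
        intro x y
        simpa using no_extra_vertical hH (x := x) (y := y)
      have hy : ∀ y, t * y + 1 = 0 ↔ y = -1 / t := by
        intro y
        rw [eq_div_iff ht]
        constructor <;> intro h <;> linear_combination h
      ext P
      simp only [mem_singularLocus_iff one_ne_zero, hE, Set.mem_insert_iff, Set.mem_singleton_iff,
        Matrix.cons_val, zero_mul, zero_add, hy]
      aesop
    · simp
      field_simp
      simp
    · simpa using ht
  · simp only [Matrix.cons_val, zero_mul]
    refine ⟨isHomogeneous_quartic _ _, hasSingularities_singleton (P := verticalPoint) ?_
      hasSingularityAt_a6 verticalPoint_mem_lineAtInfinity,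
      position_ii one_ne_zero (t := 0) (by simp) (by simp) (by simp)⟩
    have hE : ∀ x y, ¬IsExtraSingular ![0, 1, 0, 0, 0, 1] 1 x y := by
      intro x y
      simpa using no_extra_vertical h00 (x := x) (y := y)
    ext P
    simp only [mem_singularLocus_iff one_ne_zero, hE, Set.mem_singleton_iff]
    simp

/-! ### A family around `QL 10` -/

/-- The exceptional equation of the family around `QL 10`. -/
noncomputable def exceptionalTangent : MvPolynomial (Fin 2) ℂ :=
  let s := MvPolynomial.X 0
  let t := MvPolynomial.X 1
  let S := s ^ 2 * t ^ 2
  (1 - S) * (16 * s ^ 2 * t * (2 - 3 * t) ^ 2 + 8 * (2 - 3 * t) * (1 + 3 * S) -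
    3 * (1 + 3 * S) ^ 2 * t)

theorem eval_exceptionalTangent (s t : ℂ) : exceptionalTangent.eval ![s, t] =
    (1 - s ^ 2 * t ^ 2) * (16 * s ^ 2 * t * (2 - 3 * t) ^ 2 +
      8 * (2 - 3 * t) * (1 + 3 * (s ^ 2 * t ^ 2)) - 3 * (1 + 3 * (s ^ 2 * t ^ 2)) ^ 2 * t) := by
  simp [exceptionalTangent]

theorem no_extra_tangent {s t x y : ℂ} (hH : exceptionalTangent.eval ![s, t] ≠ 0) :
    ¬IsExtraSingular ![1, 2 * t, t ^ 2 * (1 - s ^ 2 * t ^ 2), 0, 1, 0] 1 x y := by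
  rintro ⟨τ, hτ, rfl, h1, h2, h3⟩
  simp [conicEval] at h1 h2 h3
  have ht : t ≠ 0 := by
    rintro rfl
    simp at h3
  rw [eval_exceptionalTangent] at hH
  refine right_ne_zero_of_mul hH ?_
  -- The derivative in `x` reads `t y = τ (τ - 3/4)`, so this shift makes `t y` the product `τ v`.
  obtain ⟨v, rfl⟩ : ∃ v, τ = v + 3 / 4 := ⟨τ - 3 / 4, by ring⟩
  have hy : t * y = (v + 3 / 4) * v := by linear_combination h2 / 4
  -- Substituting the linear relation `eB` into the quadratic `eA` produces a multiple of `t`.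
  -- Cancelling it keeps `H` nonzero at the origin.
  refine (mul_eq_zero.1 (?_ : t * _ = 0)).resolve_left ht
  generalize hS : s ^ 2 * t ^ 2 = S at *
  have e2 : t * (v + 3 / 4) * (3 / 2 + 2 * S * v) = 1 := by
    linear_combination 2 * t * (1 - S) * hy - h3
  have e3 : v = t * (v + 3 / 4) * (3 / 16 + S * v ^ 2 + v) := by
    refine mul_left_cancel₀ hτ ?_
    linear_combination t * h1 -
      (t * (1 - S) * (t * y + (v + 3 / 4) * v) - 2 * t * (v + 3 / 4) ^ 2 + 1) * hy
  have eA : 16 * S * v ^ 2 + 8 * v - 3 = 0 := by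
    refine (mul_eq_zero.1 (?_ : t * (v + 3 / 4) * _ = 0)).resolve_left (mul_ne_zero ht hτ)
    linear_combination 16 * v * e2 + 16 * e3
  have eB : v * (1 + 3 * S) * t = 2 - 3 * t := by
    linear_combination 2 * e2 - t / 4 * eA
  rw [← eB]
  linear_combination t ^ 2 * (1 + 3 * S) ^ 2 * eA +
    16 * t ^ 2 * v ^ 2 * (1 + 3 * S) ^ 2 * hS

/-- The conic is `(X + t Y)² - s² t⁴ Y² + YZ`. On `Z = 0` it splits into two factors that coincide
at `s = 0`; as `t → 0` one of its points on `X = 0` tends to `[0 : 1 : 0]`, where the limit `X² +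
YZ` is tangent to `Z = 0`. -/
theorem exists_family_tangent :
    ∃ (F : (Fin 2 → ℂ) → MvPolynomial (Fin 3) ℂ) (H : MvPolynomial (Fin 2) ℂ),
      IsAnalyticFamily Set.univ F ∧ H.eval ![0, 0] ≠ 0 ∧
      (∀ s t : ℂ, H.eval ![s, t] ≠ 0 → s * t ≠ 0 → F ![s, t] ∈ QL 1) ∧
      (∀ t : ℂ, H.eval ![0, t] ≠ 0 → t ≠ 0 → F ![0, t] ∈ QL 2) ∧
      F ![0, 0] ∈ QL 10 := by
  have h00 : exceptionalTangent.eval ![0, 0] ≠ 0 := by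
    norm_num [eval_exceptionalTangent]
  have hcusps : ∀ s t : ℂ, exceptionalTangent.eval ![s, t] ≠ 0 → t ≠ 0 → HasSingularities
      (quartic ![1, 2 * t, t ^ 2 * (1 - s ^ 2 * t ^ 2), 0, 1, 0] 1)
      [(a 2, affine), (a 2, affine)] := by
    intro s t hH ht
    refine hasSingularities_two_cusps one_ne_zero ?_ (by simp) fun x y => no_extra_tangent hH
    rw [eval_exceptionalTangent] at hH
    exact mul_ne_zero (pow_ne_zero 2 ht) (left_ne_zero_of_mul hH)
  refine ⟨fun p => quartic ![1, 2 * p 1, p 1 ^ 2 * (1 - p 0 ^ 2 * p 1 ^ 2), 0, 1, 0] 1,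
    exceptionalTangent, isAnalyticFamily_quartic ?_ analyticOnNhd_const (by simp), h00, ?_, ?_, ?_⟩
  · have h0 := analyticOnNhd_proj (0 : Fin 2)
    have h1 := analyticOnNhd_proj (1 : Fin 2)
    intro i
    fin_cases i
    exacts [analyticOnNhd_const, analyticOnNhd_const.mul h1,
      (h1.pow 2).mul (analyticOnNhd_const.sub ((h0.pow 2).mul (h1.pow 2))), analyticOnNhd_const,
      analyticOnNhd_const, analyticOnNhd_const]
  · intro s t hH h
    have hs := left_ne_zero_of_mul h
    have ht := right_ne_zero_of_mul h
    refine ⟨isHomogeneous_quartic _ _, hcusps s t hH ht, ?_⟩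
    rw [eval_exceptionalTangent] at hH
    have hS := left_ne_zero_of_mul hH
    have hS1 : 1 + s * t ≠ 0 := fun h0 => hS (by linear_combination (1 - s * t) * h0)
    have hS2 : 1 - s * t ≠ 0 := fun h0 => hS (by linear_combination (1 + s * t) * h0)
    refine position_i one_ne_zero (t₁ := -1 / (t * (1 + s * t))) (t₂ := -1 / (t * (1 - s * t)))
      (mul_ne_zero (pow_ne_zero 2 ht) hS) ?_ ?_ ?_
    · intro h0
      rw [div_eq_div_iff (mul_ne_zero ht hS1) (mul_ne_zero ht hS2)] at h0
      exact mul_ne_zero ht h (by linear_combination h0 / 2)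
    · simp only [Matrix.cons_val]
      rw [show 1 - s ^ 2 * t ^ 2 = (1 + s * t) * (1 - s * t) by ring]
      generalize 1 + s * t = p at *
      generalize 1 - s * t = q at *
      field_simp
    · simp only [Matrix.cons_val]
      rw [show 1 - s ^ 2 * t ^ 2 = (1 + s * t) * (1 - s * t) by ring]
      have hsum : (1 + s * t) + (1 - s * t) = 2 := by ring
      generalize 1 + s * t = p at *
      generalize 1 - s * t = q at *
      field_simp
      linear_combination -hsum
  · intro t hH ht
    refine ⟨isHomogeneous_quartic _ _, hcusps 0 t hH ht, position_iv one_ne_zero (t := -1 / t)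
      (by simp [ht]) ?_ ?_⟩
    · simp
      field_simp
    · simp
      field_simp
  · have hF : quartic ![1, 2 * 0, 0 ^ 2 * (1 - 0 ^ 2 * 0 ^ 2), 0, 1, 0] 1 =
        quartic ![1, 0, 0, 0, 1, 0] 1 := by simp
    simp only [Matrix.cons_val]
    rw [hF]
    refine ⟨isHomogeneous_quartic _ _, hasSingularities_pair (P₁ := verticalPoint)
      (P₂ := affinePoint 0 0) affinePoint_ne_verticalPoint.symm ?_ hasSingularityAt_a4
      verticalPoint_mem_lineAtInfinity (hasSingularityAt_cusp one_ne_zero (by simp) (by simp))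
      affinePoint_notMem_lineAtInfinity, position_v (by simp) (by simp) (by simp)⟩
    have hE : ∀ x y, ¬IsExtraSingular ![1, 0, 0, 0, 1, 0] 1 x y := by
      intro x y
      simpa using no_extra_tangent h00 (x := x) (y := y)
    ext P
    simp only [mem_singularLocus_iff one_ne_zero, hE, Set.mem_insert_iff, Set.mem_singleton_iff]
    simp

/-! ### The arrows as one-parameter restrictions -/

theorem analyticOnNhd_vec2 {f g : ℂ → ℂ} (hf : AnalyticOnNhd ℂ f Set.univ)
    (hg : AnalyticOnNhd ℂ g Set.univ) : AnalyticOnNhd ℂ (fun s => ![f s, g s]) Set.univ := by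
  refine AnalyticOnNhd.pi fun i => ?_
  fin_cases i
  exacts [hf, hg]

theorem analyticOnNhd_vec3 {f g h : ℂ → ℂ} (hf : AnalyticOnNhd ℂ f Set.univ)
    (hg : AnalyticOnNhd ℂ g Set.univ) (hh : AnalyticOnNhd ℂ h Set.univ) :
    AnalyticOnNhd ℂ (fun s => ![f s, g s, h s]) Set.univ := by
  refine AnalyticOnNhd.pi fun i => ?_
  fin_cases i
  exacts [hf, hg, hh]

end QLConf

open QLConf in
theorem mainTheorem4 :
    -- the arrows of the diagram
    (DegeneratesTo 1 2 ∧ DegeneratesTo 1 3 ∧ DegeneratesTo 1 6 ∧ DegeneratesTo 1 7 ∧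
      DegeneratesTo 2 4 ∧ DegeneratesTo 2 8 ∧ DegeneratesTo 2 10 ∧
      DegeneratesTo 3 4 ∧ DegeneratesTo 3 5 ∧ DegeneratesTo 6 9 ∧
      DegeneratesTo 7 8 ∧ DegeneratesTo 7 11 ∧ DegeneratesTo 8 12 ∧ DegeneratesTo 11 12) ∧
    -- first family: parameters `s, t, u` outside an exceptional hypersurface `H = 0`
    -- that avoids the `t`-axis and the `u`-axis
    (∃ (F : (Fin 3 → ℂ) → MvPolynomial (Fin 3) ℂ) (H : MvPolynomial (Fin 3) ℂ),
      IsAnalyticFamily Set.univ F ∧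
      (∀ t : ℂ, H.eval ![0, t, 0] ≠ 0) ∧ (∀ u : ℂ, H.eval ![0, 0, u] ≠ 0) ∧
      (∀ s t u : ℂ, H.eval ![s, t, u] ≠ 0 → s * t * u ≠ 0 → F ![s, t, u] ∈ QL 1) ∧
      (∀ t u : ℂ, H.eval ![0, t, u] ≠ 0 → t * u ≠ 0 → F ![0, t, u] ∈ QL 7) ∧
      (∀ t : ℂ, t ≠ 0 → F ![0, t, 0] ∈ QL 11) ∧
      (∀ s u : ℂ, H.eval ![s, 0, u] ≠ 0 → s * u ≠ 0 → F ![s, 0, u] ∈ QL 2) ∧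
      (∀ u : ℂ, u ≠ 0 → F ![0, 0, u] ∈ QL 8) ∧
      F ![0, 0, 0] ∈ QL 12) ∧
    -- second family: the exceptional hypersurface avoids both axes except possibly the origin
    (∃ (F : (Fin 3 → ℂ) → MvPolynomial (Fin 3) ℂ) (H : MvPolynomial (Fin 3) ℂ),
      IsAnalyticFamily Set.univ F ∧
      (∀ t : ℂ, t ≠ 0 → H.eval ![0, t, 0] ≠ 0) ∧ (∀ u : ℂ, u ≠ 0 → H.eval ![0, 0, u] ≠ 0) ∧
      (∀ s t u : ℂ, H.eval ![s, t, u] ≠ 0 → s * t * u ≠ 0 → F ![s, t, u] ∈ QL 1) ∧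
      (∀ t u : ℂ, H.eval ![0, t, u] ≠ 0 → t * u ≠ 0 → F ![0, t, u] ∈ QL 3) ∧
      (∀ t : ℂ, t ≠ 0 → F ![0, t, 0] ∈ QL 5) ∧
      (∀ s u : ℂ, H.eval ![s, 0, u] ≠ 0 → s * u ≠ 0 → F ![s, 0, u] ∈ QL 2) ∧
      (∀ u : ℂ, u ≠ 0 → F ![0, 0, u] ∈ QL 4)) ∧
    -- third family: parameters `s, t`; the exceptional curve `H = 0` avoids the origin
    (∃ (F : (Fin 2 → ℂ) → MvPolynomial (Fin 3) ℂ) (H : MvPolynomial (Fin 2) ℂ),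
      IsAnalyticFamily Set.univ F ∧ H.eval ![0, 0] ≠ 0 ∧
      (∀ s t : ℂ, H.eval ![s, t] ≠ 0 → s * t ≠ 0 → F ![s, t] ∈ QL 1) ∧
      (∀ t : ℂ, H.eval ![0, t] ≠ 0 → t ≠ 0 → F ![0, t] ∈ QL 6) ∧
      F ![0, 0] ∈ QL 9) ∧
    -- fourth family: likewise
    (∃ (F : (Fin 2 → ℂ) → MvPolynomial (Fin 3) ℂ) (H : MvPolynomial (Fin 2) ℂ),
      IsAnalyticFamily Set.univ F ∧ H.eval ![0, 0] ≠ 0 ∧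
      (∀ s t : ℂ, H.eval ![s, t] ≠ 0 → s * t ≠ 0 → F ![s, t] ∈ QL 1) ∧
      (∀ t : ℂ, H.eval ![0, t] ≠ 0 → t ≠ 0 → F ![0, t] ∈ QL 2) ∧
      F ![0, 0] ∈ QL 10) := by
  obtain ⟨F₁, H₁, hF₁, h₁t, h₁u, h₁a, h₁b, h₁c, h₁d, h₁e, h₁f⟩ := exists_family_E6
  obtain ⟨F₂, H₂, hF₂, h₂t, h₂u, h₂a, h₂b, h₂c, h₂d, h₂e⟩ := exists_family_node
  obtain ⟨F₃, H₃, hF₃, h₃o, h₃a, h₃b, h₃c⟩ := exists_family_vertical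
  obtain ⟨F₄, H₄, hF₄, h₄o, h₄a, h₄b, h₄c⟩ := exists_family_tangent
  have hid : AnalyticOnNhd ℂ (fun s : ℂ => s) Set.univ := analyticOnNhd_id
  have hcont : ∀ {n : ℕ} (H : MvPolynomial (Fin n) ℂ) {γ : ℂ → Fin n → ℂ},
      AnalyticOnNhd ℂ γ Set.univ → Continuous fun s => H.eval (γ s) := fun H γ hγ =>
    (MvPolynomial.continuous_eval H).comp (continuousOn_univ.1 hγ.continuousOn)
  have hs : ∀ b c : ℂ, AnalyticOnNhd ℂ (fun s : ℂ => ![s, b, c]) Set.univ := fun b c =>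
    analyticOnNhd_vec3 hid analyticOnNhd_const analyticOnNhd_const
  have ht : ∀ a c : ℂ, AnalyticOnNhd ℂ (fun t : ℂ => ![a, t, c]) Set.univ := fun a c =>
    analyticOnNhd_vec3 analyticOnNhd_const hid analyticOnNhd_const
  have hu : ∀ a b : ℂ, AnalyticOnNhd ℂ (fun u : ℂ => ![a, b, u]) Set.univ := fun a b =>
    analyticOnNhd_vec3 analyticOnNhd_const analyticOnNhd_const hid
  have hs' : ∀ b : ℂ, AnalyticOnNhd ℂ (fun s : ℂ => ![s, b]) Set.univ := fun b =>
    analyticOnNhd_vec2 hid analyticOnNhd_const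
  have ht' : ∀ a : ℂ, AnalyticOnNhd ℂ (fun t : ℂ => ![a, t]) Set.univ := fun a =>
    analyticOnNhd_vec2 analyticOnNhd_const hid
  -- Arrows starting at `QL 1` need a base point inside a stratum of the parameter space. It is
  -- found by moving slightly off a point where `H` is known to be nonzero.
  obtain ⟨s₁, hs₁, hHs₁⟩ := exists_ne_zero_apply_ne_zero (hcont H₁ (hs 0 1)) (h₁u 1)
  obtain ⟨u₁, hu₁, hHu₁⟩ := exists_ne_zero_apply_ne_zero (hcont H₁ (hu 0 1)) (h₁t 1)
  obtain ⟨u₂, hu₂, hHu₂⟩ :=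
    exists_ne_zero_apply_ne_zero (hcont H₂ (hu 0 1)) (h₂t 1 one_ne_zero)
  obtain ⟨t₃, ht₃, hHt₃⟩ := exists_ne_zero_apply_ne_zero (hcont H₃ (ht' 0)) h₃o
  refine ⟨⟨?_, ?_, ?_, ?_, ?_, ?_, ?_, ?_, ?_, ?_, ?_, ?_, ?_, ?_⟩,
    ⟨F₁, H₁, hF₁, h₁t, h₁u, h₁a, h₁b, h₁c, h₁d, h₁e, h₁f⟩,
    ⟨F₂, H₂, hF₂, h₂t, h₂u, h₂a, h₂b, h₂c, h₂d, h₂e⟩,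
    ⟨F₃, H₃, hF₃, h₃o, h₃a, h₃b, h₃c⟩, ⟨F₄, H₄, hF₄, h₄o, h₄a, h₄b, h₄c⟩⟩
  · exact .of_family hF₁ _ (ht s₁ 1) (hcont H₁ (ht s₁ 1)) hHs₁
      (fun t h h0 => h₁a _ _ _ h (by simp [hs₁, h0])) (h₁d _ _ hHs₁ (by simp [hs₁]))
  · exact .of_family hF₂ _ (hs 1 u₂) (hcont H₂ (hs 1 u₂)) hHu₂
      (fun s h h0 => h₂a _ _ _ h (by simp [hu₂, h0])) (h₂b _ _ hHu₂ (by simp [hu₂]))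
  · exact .of_family hF₃ _ (hs' t₃) (hcont H₃ (hs' t₃)) hHt₃
      (fun s h h0 => h₃a _ _ h (mul_ne_zero h0 ht₃)) (h₃b _ hHt₃ ht₃)
  · exact .of_family hF₁ _ (hs 1 u₁) (hcont H₁ (hs 1 u₁)) hHu₁
      (fun s h h0 => h₁a _ _ _ h (by simp [hu₁, h0])) (h₁b _ _ hHu₁ (by simp [hu₁]))
  · exact .of_family hF₂ _ (hs 0 1) (hcont H₂ (hs 0 1)) (h₂u 1 one_ne_zero)
      (fun s h h0 => h₂d _ _ h (by simp [h0])) (h₂e 1 one_ne_zero)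
  · exact .of_family hF₁ _ (hs 0 1) (hcont H₁ (hs 0 1)) (h₁u 1)
      (fun s h h0 => h₁d _ _ h (by simp [h0])) (h₁e 1 one_ne_zero)
  · exact .of_family hF₄ _ (ht' 0) (hcont H₄ (ht' 0)) h₄o (fun t h h0 => h₄b _ h h0) h₄c
  · exact .of_family hF₂ _ (ht 0 1) (hcont H₂ (ht 0 1)) (h₂u 1 one_ne_zero)
      (fun t h h0 => h₂b _ _ h (by simp [h0])) (h₂e 1 one_ne_zero)
  · exact .of_family hF₂ _ (hu 0 1) (hcont H₂ (hu 0 1)) (h₂t 1 one_ne_zero)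
      (fun u h h0 => h₂b _ _ h (by simp [h0])) (h₂c 1 one_ne_zero)
  · exact .of_family hF₃ _ (ht' 0) (hcont H₃ (ht' 0)) h₃o (fun t h h0 => h₃b _ h h0) h₃c
  · exact .of_family hF₁ _ (ht 0 1) (hcont H₁ (ht 0 1)) (h₁u 1)
      (fun t h h0 => h₁b _ _ h (by simp [h0])) (h₁e 1 one_ne_zero)
  · exact .of_family hF₁ _ (hu 0 1) (hcont H₁ (hu 0 1)) (h₁t 1)
      (fun u h h0 => h₁b _ _ h (by simp [h0])) (h₁c 1 one_ne_zero)
  -- On the two axes membership holds for every nonzero parameter, so for the last two arrows the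
  -- constant `1` replaces `H`.
  · exact .of_family hF₁ _ (hu 0 0) (continuous_const (y := (1 : ℂ))) one_ne_zero
      (fun u _ h0 => h₁e u h0) h₁f
  · exact .of_family hF₁ _ (ht 0 0) (continuous_const (y := (1 : ℂ))) one_ne_zero
      (fun t _ h0 => h₁c t h0) h₁f
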